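/- Fix $1\le p\le\infty$ and let $I_p=\{1,\dots,p\}$ if $p<\infty$ and $I_p=\mathbb N=\{1,2,\dots\}$ if $p=\infty$. For a complex-valued continuous kernel $M(x,t)$, $0\le t\le x\le\pi$, let $Q(M)$ be the boundary value problem $$iy'(x)+\int_0^x M(x,t)y(t)\,dt=\lambda y(x),\quad x\in[0,\pi],\qquad y(\pi)=0 .$$ Let $M_0(x,t)$ and $R_j(x,t)$, $j\in I_p$, be continuous complex-valued functions on the triangle $0\le t\le x\le\pi$ such that for every $j\in I_p$ $$\int_0^x R_j(\pi-t,x-t)\,dt\neq 0,\quad 0<x\le\pi,$$ and let $P_j,\tilde P_j$, $j\in I_p$, be continuous complex-valued functions on $[0,\pi]$. Put $$M(x,t)=M_0(x,t)+\sum_{j=1}^p R_j(x,t)P_j(x-t),\qquad \tilde M(x,t)=M_0(x,t)+\sum_{j=1}^p R_j(x,t)\tilde P_j(x-t),$$ where for $p=\infty$ both series are assumed to converge uniformly on the triangle $0\le t\le x\le\pi$. For $k\in I_p$ put $$M_k(x,t)=M_0(x,t)+\sum_{j=1}^k R_j(x,t)P_j(x-t),\qquad \tilde M_k(x,t)=M_0(x,t)+\sum_{j=1}^k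 R_j(x,t)\tilde P_j(x-t).$$ If for every $k\in I_p$ the problems $Q(M_k)$ and $Q(\tilde M_k)$ have the same eigenvalues, counted with (algebraic) multiplicities, then $M(x,t)=\tilde M(x,t)$ for all $0\le t\le x\le\pi$. -/

import Mathlib

open Real Set Filter Topology

/-- The triangle `0 ≤ t ≤ x ≤ π`, as a set of pairs `(x, t)`. -/
def triangle : Set (ℝ × ℝ) := {q | 0 ≤ q.2 ∧ q.2 ≤ q.1 ∧ q.1 ≤ π}

/-- The extension to the real line of a function on `[0, π]` (constant outside the interval). It is
only ever evaluated or differentiated within `[0, π]`. -/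
noncomputable def extendIcc (y : (Icc (0 : ℝ) π → ℂ)) : ℝ → ℂ := IccExtend pi_nonneg y

/-- `y` is differentiable on `[0, π]` (with one-sided derivatives at the end points) and `ℓ y = g`,
where `ℓ y (x) = i y'(x) + ∫ t in 0..x, M(x, t) y(t)`. -/
def EllEq (M : ℝ → ℝ → ℂ) (y g : (Icc (0 : ℝ) π → ℂ)) : Prop :=
  ∀ x ∈ Icc (0 : ℝ) π, ∃ d : ℂ, HasDerivWithinAt (extendIcc y) d (Icc 0 π) x ∧
    Complex.I * d + (∫ t in (0 : ℝ)..x, M x t * extendIcc y t) = extendIcc g x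

/-- `y` belongs to the kernel of `(L - lam)^m`, where `L` is the operator `y ↦ ℓ y` with the boundary
condition `y(π) = 0`, acting on differentiable functions on `[0, π]`. That is, `y` starts a chain
of length `m` of root functions: `ℓ y = lam y + g`, `y(π) = 0`, with `g` in the kernel of
`(L - lam)^(m - 1)`. -/
def IsRootFunction (M : ℝ → ℝ → ℂ) (lam : ℂ) : ℕ → (Icc (0 : ℝ) π → ℂ) → Prop
  | 0, y => y = 0
  | m + 1, y => extendIcc y π = 0 ∧ ∃ g : Icc (0 : ℝ) π → ℂ, EllEq M y (lam • y + g) ∧ IsRootFunction M lam m g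

/-- The root subspace (generalized eigenspace) of the boundary value problem
`ℓ y = lam y`, `y(π) = 0`. For `M` continuous on the triangle, the root functions already form a
linear space; the span only spares a proof of this. -/
noncomputable def rootSpace (M : ℝ → ℝ → ℂ) (lam : ℂ) : Submodule ℂ (Icc (0 : ℝ) π → ℂ) :=
  Submodule.span ℂ {y | ∃ m, IsRootFunction M lam m y}

/-- The (algebraic) multiplicity of `lam` as an eigenvalue of the boundary value problem
`ℓ y = lam y`, `y(π) = 0`; it is zero exactly if `lam` is not an eigenvalue. -/
noncomputable def eigenvalueMultiplicity (M : ℝ → ℝ → ℂ) (lam : ℂ) : Cardinal :=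
  Module.rank ℂ (rootSpace M lam)

/-- The boundary value problems with kernels `M` and `N` have the same eigenvalues, counted with
multiplicities. -/
def SameSpectrum (M N : ℝ → ℝ → ℂ) : Prop :=
  ∀ lam : ℂ, eigenvalueMultiplicity M lam = eigenvalueMultiplicity N lam

/-- The index set `I_p`: `{1, …, p}` if `p` is finite, all positive integers if `p = ∞`. -/
def indexSet (p : ℕ∞) : Set ℕ := {j | 1 ≤ j ∧ (j : ℕ∞) ≤ p}

/-- The truncated kernel
`M_k(x, t) = M_0(x, t) + ∑_{j = 1}^k R_j(x, t) P_j(x - t)`. -/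
noncomputable def truncKernel (M₀ : ℝ → ℝ → ℂ) (R : ℕ → ℝ → ℝ → ℂ) (P : ℕ → ℝ → ℂ) (k : ℕ) :
    ℝ → ℝ → ℂ :=
  fun x t => M₀ x t + ∑ j ∈ Finset.Icc 1 k, R j x t * P j (x - t)

/-- `M(x, t) = M_0(x, t) + ∑_{j = 1}^p R_j(x, t) P_j(x - t)` on the triangle, where for `p = ∞` the
series converges uniformly on the triangle. -/
def IsFullKernel (p : ℕ∞) (M₀ : ℝ → ℝ → ℂ) (R : ℕ → ℝ → ℝ → ℂ) (P : ℕ → ℝ → ℂ)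
    (M : ℝ → ℝ → ℂ) : Prop :=
  (∀ n : ℕ, p = n → ∀ x t : ℝ, (x, t) ∈ triangle → M x t = truncKernel M₀ R P n x t) ∧
  (p = ⊤ → TendstoUniformlyOn (fun k (q : ℝ × ℝ) => truncKernel M₀ R P k q.1 q.2)
    (fun q => M q.1 q.2) atTop triangle)

/-! With `s = x - t` and `n(x, s) = i M(x, x - s)`, the equation reads `y' = -iλy + ∫ n(x, s) y(x -
s) ds`. A transformation operator `Tφ(x) = φ(x) + ∫ k(x, s) φ(x - s) ds`, independent of `λ`,
carries `exp(-iλx)` to the solution with `y(0) = 1`. Its kernel vanishes for `x = s`, and `∂k/∂x = n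
+ (Volterra term in n and k)`; it is found by a contraction argument
(`exists_isTransformationKernel`, `hasDerivWithinAt_transform`).

The characteristic function `Δ(λ) = T exp(-iλ·)(π)` is entire of exponential type, and the order of
its zero at `λ` is the algebraic multiplicity: `T` carries the normalized `λ`-derivatives of
`exp(-iλx)` to a chain of root functions (`eigenvalueMultiplicity_eq`). If two problems share their
spectrum, the quotient of their characteristic functions is the exponential of an affine function
(`eq_exp_affine_mul`). Both are asymptotic to `exp(τπ)` at `λ = iτ`, so the quotient is `1`
(`charFun_eq_of_sameSpectrum`), and Fourier uniqueness gives `k(π, ·) = k'(π, ·)`.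

When `n - n' = ρ(x, s) p(s)`, the difference `(k - k')(π, s)` equals `p(s) ∫_s^π ρ(z, s) dz` plus a
Volterra remainder. The hypothesis on `R_j` says that this integral is nonzero for `s < π`. In a
norm weighted by `exp(-βs)` with large `β` the remainder is negligible, so `p = 0`
(`eq_zero_of_kernel_eq_at_pi`). The theorem follows by induction on `k`: once the earlier factors
agree, `M_k` and its counterpart differ in one term only. -/

/-! ### Estimates and continuity of integrals. -/

/-- A Laplace-type bound for the integral of a function with exponential growth. -/
theorem norm_integral_le_exp_mul {F : ℝ → ℂ} {s β B : ℝ} (hs : 0 ≤ s) (hβ : 0 < β) (hB : 0 ≤ B)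
    (hF : ∀ r, 0 ≤ r → r ≤ s → ‖F r‖ ≤ B * rexp (β * r)) :
    ‖∫ r in (0 : ℝ)..s, F r‖ ≤ B * rexp (β * s) / β := by
  have h1 : ‖∫ r in (0 : ℝ)..s, F r‖ ≤ ∫ r in (0 : ℝ)..s, B * rexp (β * r) := by
    refine intervalIntegral.norm_integral_le_of_norm_le hs ?_ ?_
    · exact Eventually.of_forall fun r hr => hF r hr.1.le hr.2
    · exact Continuous.intervalIntegrable (by fun_prop) _ _
  refine h1.trans ?_
  rw [intervalIntegral.integral_const_mul,
    intervalIntegral.integral_comp_mul_left (fun r => rexp r) hβ.ne',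
    integral_exp]
  simp only [mul_zero, Real.exp_zero, smul_eq_mul]
  have : B * (β⁻¹ * (rexp (β * s) - 1)) ≤ B * (β⁻¹ * rexp (β * s)) := by
    gcongr
    linarith
  refine this.trans (le_of_eq ?_)
  ring

/-- Interchanging the order of integration over a triangle. -/
theorem integral_triangle_swap {J : ℝ → ℝ → ℂ} (hJ : Continuous (Function.uncurry J)) {x : ℝ}
    (hx : 0 ≤ x) :
    ∫ s in (0 : ℝ)..x, ∫ z in s..x, J z s = ∫ z in (0 : ℝ)..x, ∫ s in (0 : ℝ)..z, J z s := by
  have key := MeasureTheory.integral_integral_swap (μ := MeasureTheory.volume.restrict (Ioc 0 x))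
    (ν := MeasureTheory.volume.restrict (Ioc 0 x))
    (f := fun s z => ({q : ℝ × ℝ | q.1 < q.2}.indicator (fun q => J q.2 q.1) (s, z))) ?_
  · rw [intervalIntegral.integral_of_le hx, intervalIntegral.integral_of_le hx]
    have e1 : ∫ s in Ioc 0 x, ∫ z in s..x, J z s = ∫ s in Ioc 0 x, ∫ z in Ioc 0 x,
        ({q : ℝ × ℝ | q.1 < q.2}.indicator (fun q => J q.2 q.1) (s, z)) := by
      refine MeasureTheory.setIntegral_congr_fun measurableSet_Ioc fun s hs => ?_
      have : (fun z => ({q : ℝ × ℝ | q.1 < q.2}.indicator (fun q => J q.2 q.1) (s, z)))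
          = (Ioi s).indicator fun z => J z s := by
        ext z; simp [indicator]
      simp only [this]
      rw [MeasureTheory.setIntegral_indicator measurableSet_Ioi,
        intervalIntegral.integral_of_le hs.2, Ioc_inter_Ioi, max_eq_right hs.1.le]
    have e2 : ∫ z in Ioc 0 x, ∫ s in (0 : ℝ)..z, J z s = ∫ z in Ioc 0 x, ∫ s in Ioc 0 x,
        ({q : ℝ × ℝ | q.1 < q.2}.indicator (fun q => J q.2 q.1) (s, z)) := by
      refine MeasureTheory.setIntegral_congr_fun measurableSet_Ioc fun z hz => ?_
      have : (fun s => ({q : ℝ × ℝ | q.1 < q.2}.indicator (fun q => J q.2 q.1) (s, z)))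
          = (Iio z).indicator fun s => J z s := by
        ext s; simp [indicator]
      simp only [this]
      rw [MeasureTheory.setIntegral_indicator measurableSet_Iio,
        intervalIntegral.integral_of_le hz.1.le, MeasureTheory.integral_Ioc_eq_integral_Ioo]
      congr 2
      ext s
      simp only [mem_Ioo, mem_inter_iff, mem_Ioc, mem_Iio]
      exact ⟨fun h => ⟨⟨h.1, h.2.le.trans hz.2⟩, h.2⟩, fun h => ⟨h.1.1, h.2⟩⟩
    rw [e1, e2, key]
  · have hm : MeasurableSet {q : ℝ × ℝ | q.1 < q.2} := measurableSet_lt measurable_fst measurable_snd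
    have : MeasureTheory.Integrable (fun q : ℝ × ℝ => J q.2 q.1)
        ((MeasureTheory.volume.restrict (Ioc 0 x)).prod
          (MeasureTheory.volume.restrict (Ioc 0 x))) := by
      rw [MeasureTheory.Measure.prod_restrict]
      have hc : Continuous fun q : ℝ × ℝ => J q.2 q.1 := hJ.comp continuous_swap
      exact (hc.continuousOn.integrableOn_compact
        (isCompact_Icc.prod isCompact_Icc)).mono_set (prod_mono Ioc_subset_Icc_self
          Ioc_subset_Icc_self)
    exact this.indicator hm

theorem continuous_integral_param {X : Type*} [TopologicalSpace X]
    {f : X → ℝ → ℂ} (hf : Continuous f.uncurry) {a b : X → ℝ} (ha : Continuous a)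
    (hb : Continuous b) : Continuous fun x => ∫ t in a x..b x, f x t := by
  have hi : ∀ x u v, IntervalIntegrable (f x) MeasureTheory.volume u v := fun x u v =>
    (show Continuous (f x) from hf.comp (f := fun t => (x, t)) (by fun_prop)).intervalIntegrable _ _
  have : (fun x => ∫ t in a x..b x, f x t) =
      fun x => (∫ t in (0 : ℝ)..b x, f x t) - ∫ t in (0 : ℝ)..a x, f x t := by
    ext x
    rw [intervalIntegral.integral_interval_sub_left (hi _ _ _) (hi _ _ _)]
  rw [this]
  exact (intervalIntegral.continuous_parametric_intervalIntegral_of_continuous hf hb).sub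
    (intervalIntegral.continuous_parametric_intervalIntegral_of_continuous hf ha)

/-! ### Existence of the transformation kernel. -/

/-- The derivative of the transformation kernel along its first variable, in the coordinates
`(x, x - t)`. -/
noncomputable def lagSource (n k : ℝ → ℝ → ℂ) (z s : ℝ) : ℂ :=
  n z s + ∫ r in (0 : ℝ)..s, n z (s - r) * k (z - s + r) r

theorem continuous_lagSource {n k : ℝ → ℝ → ℂ} (hn : Continuous n.uncurry)
    (hk : Continuous k.uncurry) : Continuous (lagSource n k).uncurry := by
  have : Continuous fun q : ℝ × ℝ =>
      n q.1 q.2 + ∫ r in (0 : ℝ)..q.2, n q.1 (q.2 - r) * k (q.1 - q.2 + r) r := by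
    refine Continuous.add hn (continuous_integral_param (f := fun (q : ℝ × ℝ) r =>
      n q.1 (q.2 - r) * k (q.1 - q.2 + r) r) ?_ continuous_const continuous_snd)
    exact (hn.comp (g := n.uncurry) (f := fun w : (ℝ × ℝ) × ℝ => (w.1.1, w.1.2 - w.2))
      (by fun_prop)).mul (hk.comp (g := k.uncurry)
        (f := fun w : (ℝ × ℝ) × ℝ => (w.1.1 - w.1.2 + w.2, w.2)) (by fun_prop))
  exact this

/-- For `(z, s)` in the triangle, the points `(z, s - r)` and `(z - s + r, r)` with `0 ≤ r ≤ s` stay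
in it. -/
theorem lagSource_congr {n n' k k' : ℝ → ℝ → ℂ} {z s : ℝ} (hs : 0 ≤ s) (hz : s ≤ z) (hπ : z ≤ π)
    (hn : ∀ x s, 0 ≤ s → s ≤ x → x ≤ π → n x s = n' x s)
    (hk : ∀ x s, 0 ≤ s → s ≤ x → x ≤ π → k x s = k' x s) :
    lagSource n k z s = lagSource n' k' z s := by
  unfold lagSource
  rw [hn z s hs hz hπ]
  congr 1
  refine intervalIntegral.integral_congr fun r hr => ?_
  rw [uIcc_of_le hs] at hr
  rw [hn z (s - r) (by linarith [hr.2]) (by linarith [hr.1]) hπ,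
    hk (z - s + r) r hr.1 (by linarith) (by linarith [hr.2])]

/-- The projection of the real line onto `[0, π]`. -/
noncomputable def clampPi (x : ℝ) : ℝ := max 0 (min x π)

@[fun_prop] theorem continuous_clampPi : Continuous clampPi := by unfold clampPi; fun_prop

theorem clampPi_mem (x : ℝ) : clampPi x ∈ Icc 0 π :=
  ⟨le_max_left _ _, max_le pi_pos.le (min_le_right _ _)⟩

theorem clampPi_of_mem {x : ℝ} (h0 : 0 ≤ x) (h1 : x ≤ π) : clampPi x = x := by
  simp [clampPi, h0, h1]

/-- `k(x, s)` is the kernel, in the coordinates `(x, x - t)`, of the transformation operator for the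
kernel `n(x, x - t)`, and `G` is its derivative in `x`. -/
structure IsTransformationKernel (n k G : ℝ → ℝ → ℂ) : Prop where
  continuous_source : Continuous G.uncurry
  continuous_kernel : Continuous k.uncurry
  kernel_eq : ∀ x s, k x s = ∫ z in s..x, G z s
  source_eq : ∀ z s, 0 ≤ s → s ≤ z → z ≤ π → G z s = lagSource n k z s

/-- The map whose fixed point is the transformation kernel divided by `exp (β s)`. -/
noncomputable def weightedKernelMap (n : ℝ → ℝ → ℂ) (β : ℝ) (h : ℝ → ℝ → ℂ) (x s : ℝ) : ℂ :=
  ∫ z in s..x, (n z s * rexp (-(β * s)) +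
    ∫ r in (0 : ℝ)..s, n z (s - r) * rexp (-(β * (s - r))) * h (z - s + r) r)

theorem continuous_weightedKernelMap {n : ℝ → ℝ → ℂ} (hn : Continuous n.uncurry) (β : ℝ)
    {h : ℝ → ℝ → ℂ} (hh : Continuous h.uncurry) :
    Continuous (weightedKernelMap n β h).uncurry := by
  refine continuous_integral_param (f := fun (q : ℝ × ℝ) z => n z q.2 * rexp (-(β * q.2)) +
    ∫ r in (0 : ℝ)..q.2, n z (q.2 - r) * rexp (-(β * (q.2 - r))) * h (z - q.2 + r) r)
    ?_ continuous_snd continuous_fst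
  have h1 : Continuous fun w : (ℝ × ℝ) × ℝ => n w.2 w.1.2 :=
    hn.comp (g := n.uncurry) (f := fun w : (ℝ × ℝ) × ℝ => (w.2, w.1.2)) (by fun_prop)
  have h2 : Continuous fun v : ((ℝ × ℝ) × ℝ) × ℝ => n v.1.2 (v.1.1.2 - v.2) :=
    hn.comp (g := n.uncurry) (f := fun v : ((ℝ × ℝ) × ℝ) × ℝ => (v.1.2, v.1.1.2 - v.2))
      (by fun_prop)
  have h3 : Continuous fun v : ((ℝ × ℝ) × ℝ) × ℝ => h (v.1.2 - v.1.1.2 + v.2) v.2 :=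
    hh.comp (g := h.uncurry)
      (f := fun v : ((ℝ × ℝ) × ℝ) × ℝ => (v.1.2 - v.1.1.2 + v.2, v.2)) (by fun_prop)
  refine Continuous.add (h1.mul (by fun_prop)) (continuous_integral_param
    (f := fun (w : (ℝ × ℝ) × ℝ) r => n w.2 (w.1.2 - r) * rexp (-(β * (w.1.2 - r))) *
      h (w.2 - w.1.2 + r) r) ?_ continuous_const (by fun_prop))
  exact (h2.mul (by fun_prop)).mul h3

/-- The weight turns the convolution into integration against `exp(-β(s - r))`, whose mass is at
most `1/β`. This is the source of the contraction. -/
theorem norm_weightedKernel_integral_le {n : ℝ → ℝ → ℂ} {C : ℝ} (hC : ∀ x s, ‖n x s‖ ≤ C)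
    {β : ℝ} (hβ : 0 < β) {h : ℝ → ℝ → ℂ} {D : ℝ} (hD : ∀ x s, ‖h x s‖ ≤ D) (z : ℝ) {s : ℝ}
    (hs : 0 ≤ s) :
    ‖∫ r in (0 : ℝ)..s, n z (s - r) * rexp (-(β * (s - r))) * h (z - s + r) r‖ ≤ C * D / β := by
  have hC0 : 0 ≤ C := (norm_nonneg _).trans (hC 0 0)
  have hD0 : 0 ≤ D := (norm_nonneg _).trans (hD 0 0)
  have := norm_integral_le_exp_mul (F := fun r => n z (s - r) * rexp (-(β * (s - r))) *
    h (z - s + r) r) (B := C * D * rexp (-(β * s))) hs hβ (by positivity) ?_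
  · refine this.trans (le_of_eq ?_)
    rw [mul_assoc, ← Real.exp_add]
    simp
  · intro r _ _
    rw [norm_mul, norm_mul, Complex.norm_real, Real.norm_of_nonneg (Real.exp_pos _).le]
    have : rexp (-(β * (s - r))) = rexp (-(β * s)) * rexp (β * r) := by
      rw [← Real.exp_add]; ring_nf
    rw [this]
    calc ‖n z (s - r)‖ * (rexp (-(β * s)) * rexp (β * r)) * ‖h (z - s + r) r‖
        ≤ C * (rexp (-(β * s)) * rexp (β * r)) * D := by
          gcongr
          · exact hC _ _
          · exact hD _ _
      _ = _ := by ring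

/-- Banach's fixed point theorem for bounded continuous functions on the plane, with Lipschitz
constant `πC/β ≤ 1/2`. Clamping both variables bounds the length of the outer interval by `π` and
keeps `s ≥ 0`. -/
theorem exists_weightedKernel {n : ℝ → ℝ → ℂ} (hn : Continuous n.uncurry) {C : ℝ}
    (hC : ∀ x s, ‖n x s‖ ≤ C) {β : ℝ} (hβ : 0 < β) (hβC : π * C / β ≤ 1 / 2) :
    ∃ h : ℝ → ℝ → ℂ, Continuous h.uncurry ∧
      ∀ x s, h x s = weightedKernelMap n β h (clampPi x) (clampPi s) := by
  have hC0 : 0 ≤ C := (norm_nonneg _).trans (hC 0 0)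
  have hint : ∀ (h : BoundedContinuousFunction (ℝ × ℝ) ℂ), Continuous (Function.curry h).uncurry :=
    fun h => h.continuous
  have hnb : ∀ (h : BoundedContinuousFunction (ℝ × ℝ) ℂ) x s, ‖Function.curry h x s‖ ≤ ‖h‖ :=
    fun h x s => h.norm_coe_le_norm _
  have hcl : ∀ x s : ℝ, |clampPi x - clampPi s| ≤ π := fun x s => by
    have h1 := clampPi_mem x
    have h2 := clampPi_mem s
    rw [abs_le]; constructor <;> linarith [h1.1, h1.2, h2.1, h2.2]
  have hcont : ∀ h : BoundedContinuousFunction (ℝ × ℝ) ℂ, Continuous fun q : ℝ × ℝ =>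
      weightedKernelMap n β (Function.curry h) (clampPi q.1) (clampPi q.2) := fun h =>
    (continuous_weightedKernelMap hn β (hint h)).comp
      (f := fun q : ℝ × ℝ => (clampPi q.1, clampPi q.2)) (by fun_prop)
  have hbound : ∀ (h : BoundedContinuousFunction (ℝ × ℝ) ℂ) (q : ℝ × ℝ),
      ‖weightedKernelMap n β (Function.curry h) (clampPi q.1) (clampPi q.2)‖ ≤
        (C + C * ‖h‖ / β) * π := by
    intro h q
    refine (intervalIntegral.norm_integral_le_of_norm_le_const (C := C + C * ‖h‖ / β)
      fun z _ => ?_).trans ?_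
    · refine (norm_add_le _ _).trans (add_le_add ?_
        (norm_weightedKernel_integral_le hC hβ (hnb h) z (clampPi_mem _).1))
      rw [norm_mul, Complex.norm_real, Real.norm_of_nonneg (Real.exp_pos _).le]
      have : rexp (-(β * clampPi q.2)) ≤ 1 :=
        Real.exp_le_one_iff.2 (neg_nonpos.2 (mul_nonneg hβ.le (clampPi_mem _).1))
      exact (mul_le_of_le_one_right (norm_nonneg _) this).trans (hC _ _)
    · gcongr
      exact hcl _ _
  let Φ : BoundedContinuousFunction (ℝ × ℝ) ℂ → BoundedContinuousFunction (ℝ × ℝ) ℂ := fun h =>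
    BoundedContinuousFunction.ofNormedAddCommGroup _ (hcont h) _ (hbound h)
  have hΦ : ContractingWith (1 / 2) Φ := by
    refine ⟨by rw [← NNReal.coe_lt_coe]; norm_num, LipschitzWith.of_dist_le_mul fun h g => ?_⟩
    rw [BoundedContinuousFunction.dist_le (by positivity)]
    rintro ⟨x, s⟩
    rw [dist_eq_norm, dist_eq_norm]
    change ‖weightedKernelMap n β (Function.curry h) (clampPi x) (clampPi s) -
      weightedKernelMap n β (Function.curry g) (clampPi x) (clampPi s)‖ ≤ _
    have hs := (clampPi_mem s).1
    set s' := clampPi s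
    have hci : ∀ (u : ℝ → ℝ → ℂ), Continuous u.uncurry → Continuous fun w : ℝ × ℝ =>
        n w.1 (s' - w.2) * rexp (-(β * (s' - w.2))) * u (w.1 - s' + w.2) w.2 := by
      intro u hu
      have h2 : Continuous fun v : ℝ × ℝ => n v.1 (s' - v.2) :=
        hn.comp (g := n.uncurry) (f := fun v : ℝ × ℝ => (v.1, s' - v.2)) (by fun_prop)
      have h3 : Continuous fun v : ℝ × ℝ => u (v.1 - s' + v.2) v.2 :=
        hu.comp (g := u.uncurry) (f := fun v : ℝ × ℝ => (v.1 - s' + v.2, v.2)) (by fun_prop)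
      exact (h2.mul (by fun_prop)).mul h3
    have hco : ∀ (u : ℝ → ℝ → ℂ), Continuous u.uncurry → Continuous fun z =>
        n z s' * rexp (-(β * s')) +
          ∫ r in (0 : ℝ)..s', n z (s' - r) * rexp (-(β * (s' - r))) * u (z - s' + r) r := by
      intro u hu
      have h1 : Continuous fun w : ℝ => n w s' :=
        hn.comp (g := n.uncurry) (f := fun w : ℝ => (w, s')) (by fun_prop)
      exact (h1.mul continuous_const).add (continuous_integral_param
        (f := fun z r => n z (s' - r) * rexp (-(β * (s' - r))) * u (z - s' + r) r)
        (hci u hu) continuous_const continuous_const)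
    unfold weightedKernelMap
    rw [← intervalIntegral.integral_sub ((hco _ (hint h)).intervalIntegrable _ _)
      ((hco _ (hint g)).intervalIntegrable _ _)]
    have : ∀ z, (n z s' * rexp (-(β * s')) + ∫ r in (0 : ℝ)..s',
          n z (s' - r) * rexp (-(β * (s' - r))) * Function.curry h (z - s' + r) r) -
        (n z s' * rexp (-(β * s')) + ∫ r in (0 : ℝ)..s',
          n z (s' - r) * rexp (-(β * (s' - r))) * Function.curry g (z - s' + r) r) =
        ∫ r in (0 : ℝ)..s',
          n z (s' - r) * rexp (-(β * (s' - r))) * Function.curry (h - g) (z - s' + r) r := by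
      intro z
      have hz : ∀ u : BoundedContinuousFunction (ℝ × ℝ) ℂ, IntervalIntegrable (fun r =>
          n z (s' - r) * rexp (-(β * (s' - r))) * Function.curry u (z - s' + r) r)
          MeasureTheory.volume 0 s' := fun u =>
        ((hci _ (hint u)).comp (f := fun r => (z, r)) (by fun_prop)).intervalIntegrable _ _
      rw [add_sub_add_left_eq_sub, ← intervalIntegral.integral_sub (hz h) (hz g)]
      refine intervalIntegral.integral_congr fun r _ => ?_
      simp [Function.curry, mul_sub]
    simp only [this]
    refine (intervalIntegral.norm_integral_le_of_norm_le_const fun z _ =>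
      norm_weightedKernel_integral_le hC hβ (hnb (h - g)) z hs).trans ?_
    calc C * ‖h - g‖ / β * |clampPi x - s'| ≤ C * ‖h - g‖ / β * π := by
          gcongr; exact hcl _ _
      _ = (π * C / β) * ‖h - g‖ := by ring
      _ ≤ (1 / 2) * ‖h - g‖ := by gcongr
      _ = _ := by simp
  refine ⟨Function.curry (ContractingWith.fixedPoint Φ hΦ : BoundedContinuousFunction (ℝ × ℝ) ℂ),
    hint _, fun x s => ?_⟩
  exact (DFunLike.congr_fun hΦ.fixedPoint_isFixedPt (x, s)).symm

/-- Existence of the kernel of the transformation operator. -/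
theorem exists_isTransformationKernel {n : ℝ → ℝ → ℂ} (hn : Continuous n.uncurry) {C : ℝ}
    (hC : ∀ x s, ‖n x s‖ ≤ C) : ∃ k G : ℝ → ℝ → ℂ, IsTransformationKernel n k G := by
  have hC0 : 0 ≤ C := (norm_nonneg _).trans (hC 0 0)
  obtain ⟨h, hh, hfix⟩ := exists_weightedKernel hn hC (β := 2 * π * C + 1)
    (by positivity) (by
      rw [div_le_div_iff₀ (by positivity) (by positivity)]; linarith)
  set β := 2 * π * C + 1
  set k₀ : ℝ → ℝ → ℂ := fun x s => rexp (β * s) * h x s with hk₀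
  have hk₀c : Continuous k₀.uncurry := by
    have : Continuous fun q : ℝ × ℝ => (rexp (β * q.2) : ℂ) := by fun_prop
    exact this.mul hh
  have hGc := continuous_lagSource hn hk₀c
  have hk₀eq : ∀ x s, 0 ≤ s → s ≤ x → x ≤ π → k₀ x s = ∫ z in s..x, lagSource n k₀ z s := by
    intro x s hs hsx hx
    simp only [hk₀, hfix x s, clampPi_of_mem (hs.trans hsx) hx, clampPi_of_mem hs (hsx.trans hx)]
    rw [weightedKernelMap, ← intervalIntegral.integral_const_mul]
    refine intervalIntegral.integral_congr fun z _ => ?_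
    simp only [lagSource]
    rw [mul_add, ← intervalIntegral.integral_const_mul]
    congr 1
    · rw [mul_comm, mul_assoc, ← Complex.ofReal_mul, ← Real.exp_add]
      simp
    · refine intervalIntegral.integral_congr fun r _ => ?_
      have : (rexp (β * r) : ℂ) = rexp (β * s) * rexp (-(β * (s - r))) := by
        rw [← Complex.ofReal_mul, ← Real.exp_add]; ring_nf
      simp only [this]
      ring
  -- The kernel is taken to be the integral itself, not `k₀`, so that `kernel_eq` holds on the whole
  -- plane. The two agree on the triangle, and there `lagSource` does not distinguish them.
  refine ⟨fun x s => ∫ z in s..x, lagSource n k₀ z s, lagSource n k₀, hGc, ?_, fun _ _ => rfl,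
    fun z s h0 h1 h2 => lagSource_congr h0 h1 h2 (fun _ _ _ _ _ => rfl) hk₀eq⟩
  exact continuous_integral_param (f := fun (q : ℝ × ℝ) z => lagSource n k₀ z q.2)
    (hGc.comp (f := fun w : (ℝ × ℝ) × ℝ => (w.2, w.1.2)) (by fun_prop)) continuous_snd
    continuous_fst

/-! ### The transformation operator and its intertwining property. -/

/-- The transformation operator with kernel `k` in the coordinates `(x, x - t)`. -/
noncomputable def transform (k : ℝ → ℝ → ℂ) (φ : ℝ → ℂ) (x : ℝ) : ℂ :=
  φ x + ∫ s in (0 : ℝ)..x, k x s * φ (x - s)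

theorem continuous_uncurry_comp₂ {X : Type*} [TopologicalSpace X] {f : ℝ → ℝ → ℂ}
    (hf : Continuous f.uncurry) {a b : X → ℝ} (ha : Continuous a) (hb : Continuous b) :
    Continuous fun x => f (a x) (b x) :=
  hf.comp (g := f.uncurry) (f := fun x => (a x, b x)) (by fun_prop)

/-- After substitution both sides consist of `∫ n(x, s) φ(x - s) ds` and the integral of the same
`J` over a triangle, in the two orders. The convolution term of `lagSource` is shaped to make this
work. -/
theorem integral_lagSource_mul {n k G : ℝ → ℝ → ℂ} (hk : IsTransformationKernel n k G)
    (hn : Continuous n.uncurry) {φ : ℝ → ℂ} (hφ : Continuous φ) {x : ℝ} (hx : x ∈ Icc 0 π) :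
    ∫ s in (0 : ℝ)..x, G x s * φ (x - s) =
      ∫ s in (0 : ℝ)..x, n x s * transform k φ (x - s) := by
  have hkc := hk.continuous_kernel
  set J : ℝ → ℝ → ℂ := fun z σ => n x σ * k (x - σ) (z - σ) * φ (x - z) with hJ
  have hJc : Continuous J.uncurry := by
    have h1 : Continuous fun q : ℝ × ℝ => n x q.2 :=
      continuous_uncurry_comp₂ hn continuous_const continuous_snd
    have h2 : Continuous fun q : ℝ × ℝ => k (x - q.2) (q.1 - q.2) :=
      continuous_uncurry_comp₂ hkc (by fun_prop) (by fun_prop)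
    exact (h1.mul h2).mul (by fun_prop)
  have hn1 : Continuous fun s => n x s := continuous_uncurry_comp₂ hn (by fun_prop) (by fun_prop)
  have hJ1 : Continuous fun z => ∫ σ in (0 : ℝ)..z, J z σ :=
    continuous_integral_param hJc continuous_const continuous_id
  have hJ2 : Continuous fun σ => ∫ z in σ..x, J z σ :=
    continuous_integral_param (f := fun σ z => J z σ) (hJc.comp continuous_swap) continuous_id
      continuous_const
  have hL : ∫ s in (0 : ℝ)..x, G x s * φ (x - s) =
      ∫ s in (0 : ℝ)..x, (n x s * φ (x - s) + ∫ σ in (0 : ℝ)..s, J s σ) := by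
    refine intervalIntegral.integral_congr fun s hs => ?_
    rw [uIcc_of_le hx.1] at hs
    rw [hk.source_eq x s hs.1 hs.2 hx.2, lagSource, add_mul]
    congr 1
    have := intervalIntegral.integral_comp_sub_left (a := 0) (b := s)
      (fun r => n x (s - r) * k (x - s + r) r) s
    rw [sub_self, sub_zero] at this
    rw [← this, ← intervalIntegral.integral_mul_const]
    refine intervalIntegral.integral_congr fun σ _ => ?_
    simp only [hJ]
    congr 3 <;> ring_nf
  have hR : ∫ s in (0 : ℝ)..x, n x s * transform k φ (x - s) =
      ∫ s in (0 : ℝ)..x, (n x s * φ (x - s) + ∫ z in s..x, J z s) := by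
    refine intervalIntegral.integral_congr fun s hs => ?_
    simp only [transform, mul_add]
    congr 1
    have := intervalIntegral.integral_comp_sub_right (a := s) (b := x)
      (fun r => k (x - s) r * φ (x - s - r)) s
    rw [sub_self] at this
    rw [← this, ← intervalIntegral.integral_const_mul]
    refine intervalIntegral.integral_congr fun z _ => ?_
    simp only [hJ, sub_sub_sub_cancel_right]
    ring
  have h0 : Continuous fun s => n x s * φ (x - s) := hn1.mul (by fun_prop)
  rw [hL, hR, intervalIntegral.integral_add (h0.intervalIntegrable _ _)
    (hJ1.intervalIntegrable _ _), intervalIntegral.integral_add (h0.intervalIntegrable _ _)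
    (hJ2.intervalIntegrable _ _), integral_triangle_swap hJc hx.1]

/-- The transformation operator intertwines differentiation with the integro-differential
operator. -/
theorem hasDerivWithinAt_transform {n k G : ℝ → ℝ → ℂ} (hk : IsTransformationKernel n k G)
    (hn : Continuous n.uncurry) {φ ψ : ℝ → ℂ} (hφ : ∀ x, HasDerivAt φ (ψ x) x)
    (hψ : Continuous ψ) {x : ℝ} (hx : x ∈ Icc 0 π) :
    HasDerivWithinAt (transform k φ)
      (transform k ψ x + ∫ s in (0 : ℝ)..x, n x s * transform k φ (x - s)) (Icc 0 π) x := by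
  have hφc : Continuous φ := continuous_iff_continuousAt.2 fun x => (hφ x).continuousAt
  have hkc := hk.continuous_kernel
  have hGc := hk.continuous_source
  set J : ℝ → ℝ → ℂ := fun z s => G z s * φ (z - s) + k z s * ψ (z - s) with hJ
  have hJc : Continuous J.uncurry := (hGc.mul (by fun_prop)).add (hkc.mul (by fun_prop))
  have hJ0 : Continuous fun z => ∫ s in (0 : ℝ)..z, J z s :=
    continuous_integral_param hJc continuous_const continuous_id
  -- Since `k(s, s) = 0`, the product is the integral of its `x`-derivative from `s`. Exchanging the
  -- integrals then turns the derivative of `transform` into the fundamental theorem of calculus.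
  have hprod : ∀ x s, k x s * φ (x - s) = ∫ z in s..x, J z s := by
    intro x s
    have hd : ∀ z, HasDerivAt (fun z => k z s * φ (z - s)) (J z s) z := by
      intro z
      have h1 : HasDerivAt (fun z => k z s) (G z s) z := by
        simp only [hk.kernel_eq]
        have hGs : Continuous fun z => G z s :=
          continuous_uncurry_comp₂ hGc continuous_id continuous_const
        exact intervalIntegral.integral_hasDerivAt_right (hGs.intervalIntegrable _ _)
          (hGs.stronglyMeasurableAtFilter _ _) hGs.continuousAt
      exact h1.mul ((hφ (z - s)).comp_sub_const z s)
    have hJs : Continuous fun z => J z s :=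
      continuous_uncurry_comp₂ hJc continuous_id continuous_const
    rw [intervalIntegral.integral_eq_sub_of_hasDerivAt (fun z _ => hd z)
      (hJs.intervalIntegrable _ _), hk.kernel_eq s s]
    simp
  have hT : ∀ y ∈ Icc 0 π, transform k φ y = φ y + ∫ z in (0 : ℝ)..y, ∫ s in (0 : ℝ)..z, J z s := by
    intro y hy
    rw [transform, ← integral_triangle_swap hJc hy.1]
    simp only [hprod]
  have hd : HasDerivAt (fun y => φ y + ∫ z in (0 : ℝ)..y, ∫ s in (0 : ℝ)..z, J z s)
      (ψ x + ∫ s in (0 : ℝ)..x, J x s) x :=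
    (hφ x).add (intervalIntegral.integral_hasDerivAt_right (hJ0.intervalIntegrable _ _)
      (hJ0.stronglyMeasurableAtFilter _ _) hJ0.continuousAt)
  have hval : ψ x + ∫ s in (0 : ℝ)..x, J x s =
      transform k ψ x + ∫ s in (0 : ℝ)..x, n x s * transform k φ (x - s) := by
    rw [← integral_lagSource_mul hk hn hφc hx, transform]
    have h1 : Continuous fun s => G x s * φ (x - s) :=
      (continuous_uncurry_comp₂ hGc continuous_const continuous_id).mul (by fun_prop)
    have h2 : Continuous fun s => k x s * ψ (x - s) :=
      (continuous_uncurry_comp₂ hkc continuous_const continuous_id).mul (by fun_prop)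
    simp only [hJ]
    rw [intervalIntegral.integral_add (h1.intervalIntegrable _ _) (h2.intervalIntegrable _ _)]
    ring
  rw [← hval]
  exact hd.hasDerivWithinAt.congr hT (hT x hx)

/-! ### The integro-differential expression and uniqueness for its initial value problem. -/

theorem extendIcc_of_mem (y : Icc (0 : ℝ) π → ℂ) {x : ℝ} (hx : x ∈ Icc 0 π) :
    extendIcc y x = y ⟨x, hx⟩ := IccExtend_of_mem _ _ hx

theorem extendIcc_restrict (f : ℝ → ℂ) {x : ℝ} (hx : x ∈ Icc 0 π) :
    extendIcc (fun u => f u) x = f x := extendIcc_of_mem _ hx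

theorem extendIcc_add (y z : Icc (0 : ℝ) π → ℂ) :
    extendIcc (y + z) = extendIcc y + extendIcc z := rfl

theorem extendIcc_smul (c : ℂ) (y : Icc (0 : ℝ) π → ℂ) :
    extendIcc (c • y) = c • extendIcc y := rfl

theorem extendIcc_zero : extendIcc 0 = 0 := rfl

theorem isCompact_triangle : IsCompact triangle := by
  have hc : IsClosed triangle := by
    refine (isClosed_le continuous_const continuous_snd).inter
      ((isClosed_le continuous_snd continuous_fst).inter
        (isClosed_le continuous_fst continuous_const))
  refine (isCompact_Icc.prod isCompact_Icc : IsCompact (Icc 0 π ×ˢ Icc 0 π)).of_isClosed_subset hc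
    fun q hq => ⟨⟨hq.1.trans hq.2.1, hq.2.2⟩, ⟨hq.1, hq.2.1.trans hq.2.2⟩⟩

theorem exists_bound_of_continuousOn_triangle {M : ℝ → ℝ → ℂ}
    (hM : ContinuousOn (fun q : ℝ × ℝ => M q.1 q.2) triangle) :
    ∃ C, 0 ≤ C ∧ ∀ x t, (x, t) ∈ triangle → ‖M x t‖ ≤ C := by
  obtain ⟨C, hC⟩ := isCompact_triangle.exists_bound_of_continuousOn hM
  exact ⟨|C|, abs_nonneg C, fun x t h => (hC _ h).trans (le_abs_self C)⟩

theorem continuousOn_section {M : ℝ → ℝ → ℂ}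
    (hM : ContinuousOn (fun q : ℝ × ℝ => M q.1 q.2) triangle) {x : ℝ} (hx : x ∈ Icc 0 π) :
    ContinuousOn (M x) (Icc 0 x) :=
  hM.comp (f := fun t => (x, t)) (by fun_prop) fun _ ht => ⟨ht.1, ht.2, hx.2⟩

theorem EllEq.continuousOn {M : ℝ → ℝ → ℂ} {y g : Icc (0 : ℝ) π → ℂ} (h : EllEq M y g) :
    ContinuousOn (extendIcc y) (Icc 0 π) := fun x hx => by
  obtain ⟨d, hd, -⟩ := h x hx
  exact hd.continuousWithinAt

theorem EllEq.intervalIntegrable {M : ℝ → ℝ → ℂ}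
    (hM : ContinuousOn (fun q : ℝ × ℝ => M q.1 q.2) triangle) {y g : Icc (0 : ℝ) π → ℂ}
    (h : EllEq M y g) {x : ℝ} (hx : x ∈ Icc 0 π) :
    IntervalIntegrable (fun t => M x t * extendIcc y t) MeasureTheory.volume 0 x := by
  refine ContinuousOn.intervalIntegrable ?_
  rw [uIcc_of_le hx.1]
  exact (continuousOn_section hM hx).mul (h.continuousOn.mono (Icc_subset_Icc_right hx.2))

theorem EllEq.add {M : ℝ → ℝ → ℂ} (hM : ContinuousOn (fun q : ℝ × ℝ => M q.1 q.2) triangle)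
    {y g z h : Icc (0 : ℝ) π → ℂ} (hy : EllEq M y g) (hz : EllEq M z h) :
    EllEq M (y + z) (g + h) := by
  intro x hx
  obtain ⟨d, hd, hd'⟩ := hy x hx
  obtain ⟨e, he, he'⟩ := hz x hx
  refine ⟨d + e, hd.add he, ?_⟩
  rw [extendIcc_add, extendIcc_add, Pi.add_apply, ← hd', ← he']
  simp only [Pi.add_apply, mul_add]
  rw [intervalIntegral.integral_add (hy.intervalIntegrable hM hx) (hz.intervalIntegrable hM hx)]
  ring

theorem EllEq.smul {M : ℝ → ℝ → ℂ} {y g : Icc (0 : ℝ) π → ℂ} (hy : EllEq M y g) (c : ℂ) :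
    EllEq M (c • y) (c • g) := by
  intro x hx
  obtain ⟨d, hd, hd'⟩ := hy x hx
  refine ⟨c * d, hd.const_smul c, ?_⟩
  rw [extendIcc_smul, extendIcc_smul, Pi.smul_apply, ← hd']
  simp only [Pi.smul_apply, smul_eq_mul, mul_add, ← intervalIntegral.integral_const_mul]
  congr 1
  · ring
  · exact intervalIntegral.integral_congr fun t _ => by ring

theorem EllEq.unique {M : ℝ → ℝ → ℂ} {y g h : Icc (0 : ℝ) π → ℂ} (hg : EllEq M y g)
    (hh : EllEq M y h) : g = h := by
  ext ⟨x, hx⟩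
  obtain ⟨d, hd, hd'⟩ := hg x hx
  obtain ⟨e, he, he'⟩ := hh x hx
  have := (uniqueDiffOn_Icc pi_pos x hx).eq_deriv _ hd he
  rw [← extendIcc_of_mem g hx, ← extendIcc_of_mem h hx, ← hd', ← he', this]

/-- The initial value problem for the homogeneous equation has only the trivial solution. -/
theorem EllEq.eq_zero {M : ℝ → ℝ → ℂ} (hM : ContinuousOn (fun q : ℝ × ℝ => M q.1 q.2) triangle)
    {y : Icc (0 : ℝ) π → ℂ} {lam : ℂ} (hy : EllEq M y (lam • y)) (h0 : extendIcc y 0 = 0) :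
    y = 0 := by
  obtain ⟨C, hC0, hC⟩ := exists_bound_of_continuousOn_triangle hM
  set Y := extendIcc y with hY
  set K := ‖lam‖ + C with hK
  have hK0 : 0 ≤ K := by positivity
  -- Weighted Gronwall argument: if `m` is the maximum of `‖Y x‖ exp(-βx)`, the equation bounds
  -- `‖Y'‖` by `K m exp(βx)`. Integration gives `m ≤ K m / β`, which forces `m = 0` because `β > K`.
  set β := 2 * K + 1 with hβ
  have hβ1 : 1 ≤ β := by linarith
  have hβ0 : 0 < β := by linarith
  have hYc : ContinuousOn Y (Icc 0 π) := hy.continuousOn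
  obtain ⟨x₀, hx₀, hmax⟩ := isCompact_Icc.exists_isMaxOn (nonempty_Icc.2 pi_pos.le)
    (f := fun x => ‖Y x‖ * rexp (-(β * x))) (hYc.norm.mul (by fun_prop))
  set m := ‖Y x₀‖ * rexp (-(β * x₀)) with hm
  have hm0 : 0 ≤ m := by positivity
  have hYm : ∀ x ∈ Icc 0 π, ‖Y x‖ ≤ m * rexp (β * x) := by
    intro x hx
    have : ‖Y x‖ * rexp (-(β * x)) ≤ m := hmax hx
    rwa [Real.exp_neg, ← div_eq_mul_inv, div_le_iff₀ (Real.exp_pos _)] at this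
  choose! d hd hd' using hy
  have hdm : ∀ x ∈ Icc 0 π, ‖d x‖ ≤ K * m * rexp (β * x) := by
    intro x hx
    have h1 : ‖∫ t in (0 : ℝ)..x, M x t * Y t‖ ≤ C * m * rexp (β * x) := by
      refine (norm_integral_le_exp_mul (B := C * m) hx.1 hβ0 (by positivity)
        fun r hr hrx => ?_).trans (div_le_self (by positivity) hβ1)
      rw [norm_mul, mul_assoc]
      exact mul_le_mul (hC _ _ ⟨hr, hrx, hx.2⟩) (hYm r ⟨hr, hrx.trans hx.2⟩) (norm_nonneg _) hC0
    have h2 : Complex.I * d x = lam * Y x - ∫ t in (0 : ℝ)..x, M x t * Y t := by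
      rw [eq_sub_iff_add_eq, hd' x hx]
      rfl
    calc ‖d x‖ = ‖Complex.I * d x‖ := by simp
      _ ≤ ‖lam‖ * ‖Y x‖ + C * m * rexp (β * x) := by
        rw [h2]
        exact (norm_sub_le _ _).trans (add_le_add (norm_mul_le _ _) h1)
      _ ≤ ‖lam‖ * (m * rexp (β * x)) + C * m * rexp (β * x) := by
        gcongr; exact hYm x hx
      _ = _ := by rw [hK]; ring
  have hB : ∀ x, HasDerivAt (fun x => K * m / β * rexp (β * x)) (K * m * rexp (β * x)) x := by
    intro x
    refine HasDerivAt.congr_deriv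
      ((((hasDerivAt_id x).const_mul β).exp).const_mul (K * m / β)) ?_
    simp only [id]
    field_simp
  have key := image_norm_le_of_norm_deriv_right_le_deriv_boundary' (f := Y) (f' := d)
    (B := fun x => K * m / β * rexp (β * x)) (B' := fun x => K * m * rexp (β * x)) hYc
    (fun x hx => (hd x ⟨hx.1, hx.2.le⟩).mono_of_mem_nhdsWithin (Icc_mem_nhdsGE_of_mem hx))
    (by rw [h0, norm_zero]; positivity) (by fun_prop) (fun x _ => (hB x).hasDerivWithinAt)
    (fun x hx => hdm x ⟨hx.1, hx.2.le⟩) hx₀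
  have hmz : m = 0 := by
    have h1 : m ≤ K * m / β := by
      calc m = ‖Y x₀‖ * rexp (-(β * x₀)) := hm
        _ ≤ K * m / β * rexp (β * x₀) * rexp (-(β * x₀)) := by gcongr
        _ = K * m / β := by rw [mul_assoc, ← Real.exp_add]; simp
    rw [le_div_iff₀ hβ0, hβ] at h1
    nlinarith
  ext ⟨x, hx⟩
  have := hYm x hx
  rw [hmz, zero_mul, hY, extendIcc_of_mem y hx] at this
  simpa using this

/-! ### Passage from the boundary value problem to lag coordinates. -/

/-- The kernel `i M` in the coordinates `(x, x - t)`, extended from the triangle to the plane. -/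
noncomputable def lagKernel (M : ℝ → ℝ → ℂ) (x s : ℝ) : ℂ :=
  Complex.I * M (clampPi x) (clampPi x - min (clampPi s) (clampPi x))

theorem lagKernel_arg_mem (x s : ℝ) :
    (clampPi x, clampPi x - min (clampPi s) (clampPi x)) ∈ triangle := by
  have h1 := clampPi_mem x
  have h2 := clampPi_mem s
  exact ⟨sub_nonneg.2 (min_le_right _ _), by simp [h1.1, h2.1], h1.2⟩

theorem lagKernel_eq (M : ℝ → ℝ → ℂ) {x s : ℝ} (hs : 0 ≤ s) (hsx : s ≤ x) (hx : x ≤ π) :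
    lagKernel M x s = Complex.I * M x (x - s) := by
  rw [lagKernel, clampPi_of_mem (hs.trans hsx) hx, clampPi_of_mem hs (hsx.trans hx),
    min_eq_left hsx]

theorem continuous_lagKernel {M : ℝ → ℝ → ℂ}
    (hM : ContinuousOn (fun q : ℝ × ℝ => M q.1 q.2) triangle) :
    Continuous (lagKernel M).uncurry := by
  have : Continuous fun q : ℝ × ℝ =>
      M (clampPi q.1) (clampPi q.1 - min (clampPi q.2) (clampPi q.1)) :=
    hM.comp_continuous (f := fun q : ℝ × ℝ =>
      (clampPi q.1, clampPi q.1 - min (clampPi q.2) (clampPi q.1))) (by fun_prop)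
      fun q => lagKernel_arg_mem q.1 q.2
  exact continuous_const.mul this

theorem exists_isTransformationKernel_lagKernel {M : ℝ → ℝ → ℂ}
    (hM : ContinuousOn (fun q : ℝ × ℝ => M q.1 q.2) triangle) :
    ∃ k G : ℝ → ℝ → ℂ, IsTransformationKernel (lagKernel M) k G := by
  obtain ⟨C, -, hC⟩ := exists_bound_of_continuousOn_triangle hM
  refine exists_isTransformationKernel (continuous_lagKernel hM) (C := C) fun x s => ?_
  rw [lagKernel, norm_mul, Complex.norm_I, one_mul]
  exact hC _ _ (lagKernel_arg_mem x s)

theorem transform_smul_add {k : ℝ → ℝ → ℂ} (hk : Continuous k.uncurry) {φ ψ : ℝ → ℂ}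
    (hφ : Continuous φ) (hψ : Continuous ψ) (a b : ℂ) (x : ℝ) :
    transform k (fun x => a * φ x + b * ψ x) x = a * transform k φ x + b * transform k ψ x := by
  have h : ∀ f : ℝ → ℂ, Continuous f → IntervalIntegrable (fun s => k x s * f (x - s))
      MeasureTheory.volume 0 x := fun f hf =>
    ((continuous_uncurry_comp₂ hk continuous_const continuous_id).mul
      (by fun_prop)).intervalIntegrable _ _
  simp only [transform, mul_add, ← intervalIntegral.integral_const_mul]
  rw [add_add_add_comm, ← intervalIntegral.integral_add ((h φ hφ).const_mul a)
    ((h ψ hψ).const_mul b)]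
  congr 1
  exact intervalIntegral.integral_congr fun s _ => by ring

/-- Apply the intertwining relation to `φ' = -iλφ - iχ` and multiply by `i`. The term `χ` serves the
chains of root functions. -/
theorem ellEq_transform {M k G : ℝ → ℝ → ℂ}
    (hM : ContinuousOn (fun q : ℝ × ℝ => M q.1 q.2) triangle)
    (hk : IsTransformationKernel (lagKernel M) k G) {φ χ : ℝ → ℂ} {lam : ℂ} (hχ : Continuous χ)
    (hφ : ∀ x, HasDerivAt φ (-(Complex.I * lam) * φ x + -Complex.I * χ x) x) :
    EllEq M (fun x => transform k φ x)
      (lam • (fun x : Icc (0 : ℝ) π => transform k φ x) +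
        fun x : Icc (0 : ℝ) π => transform k χ x) := by
  have hφc : Continuous φ := continuous_iff_continuousAt.2 fun x => (hφ x).continuousAt
  intro x hx
  have hd := hasDerivWithinAt_transform hk (continuous_lagKernel hM) hφ
    (by fun_prop) hx
  refine ⟨_, hd.congr (fun u hu => extendIcc_restrict _ hu) (extendIcc_restrict _ hx), ?_⟩
  rw [extendIcc_add, extendIcc_smul, Pi.add_apply, Pi.smul_apply, extendIcc_restrict _ hx,
    extendIcc_restrict _ hx, transform_smul_add hk.continuous_kernel hφc hχ]
  have h1 : ∫ s in (0 : ℝ)..x, lagKernel M x s * transform k φ (x - s) =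
      Complex.I * ∫ t in (0 : ℝ)..x, M x t * transform k φ t := by
    have := intervalIntegral.integral_comp_sub_left (a := 0) (b := x)
      (fun t => M x t * transform k φ t) x
    rw [sub_self, sub_zero] at this
    rw [← this, ← intervalIntegral.integral_const_mul]
    refine intervalIntegral.integral_congr fun s hs => ?_
    rw [uIcc_of_le hx.1] at hs
    simp only [lagKernel_eq M hs.1 hs.2 hx.2]
    ring
  have h2 : ∫ t in (0 : ℝ)..x, M x t * extendIcc (fun u : Icc (0 : ℝ) π => transform k φ u) t =
      ∫ t in (0 : ℝ)..x, M x t * transform k φ t := by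
    refine intervalIntegral.integral_congr fun t ht => ?_
    rw [uIcc_of_le hx.1] at ht
    simp only [extendIcc_restrict _ (show t ∈ Icc 0 π from ⟨ht.1, ht.2.trans hx.2⟩)]
  rw [h1, h2, smul_eq_mul]
  linear_combination (-(lam * transform k φ x) - transform k χ x +
    ∫ t in (0 : ℝ)..x, M x t * transform k φ t) * Complex.I_sq

/-! ### Root chains and algebraic multiplicity. -/

/-- The normalized derivative `(d/dλ)^j exp(-iλx) / j!`. -/
noncomputable def expTaylor (lam : ℂ) (j : ℕ) (x : ℝ) : ℂ :=
  (-Complex.I * x) ^ j / j.factorial * Complex.exp (-(Complex.I * lam) * x)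

@[fun_prop] theorem continuous_expTaylor (lam : ℂ) (j : ℕ) : Continuous (expTaylor lam j) := by
  unfold expTaylor; fun_prop

theorem hasDerivAt_cexp_ofReal_mul (a : ℂ) (x : ℝ) :
    HasDerivAt (fun x : ℝ => Complex.exp (a * x)) (a * Complex.exp (a * x)) x := by
  refine HasDerivAt.congr_deriv (((hasDerivAt_id (x : ℂ)).const_mul a).cexp).comp_ofReal ?_
  simp only [id]; ring

theorem hasDerivAt_expTaylor_zero (lam : ℂ) (x : ℝ) :
    HasDerivAt (expTaylor lam 0) (-(Complex.I * lam) * expTaylor lam 0 x) x := by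
  have : expTaylor lam 0 = fun x : ℝ => Complex.exp (-(Complex.I * lam) * x) := by
    ext x; simp [expTaylor]
  rw [this]
  exact hasDerivAt_cexp_ofReal_mul _ x

theorem hasDerivAt_expTaylor_succ (lam : ℂ) (j : ℕ) (x : ℝ) :
    HasDerivAt (expTaylor lam (j + 1))
      (-(Complex.I * lam) * expTaylor lam (j + 1) x + -Complex.I * expTaylor lam j x) x := by
  have h1 : HasDerivAt (fun x : ℝ => (-Complex.I * (x : ℂ)) ^ (j + 1) / (j + 1).factorial)
      (-Complex.I * ((-Complex.I * (x : ℂ)) ^ j / j.factorial)) x := by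
    refine HasDerivAt.congr_deriv
      ((((hasDerivAt_id (x : ℂ)).const_mul (-Complex.I)).pow (j + 1)).div_const
        ((j + 1).factorial : ℂ)).comp_ofReal ?_
    have : (j.factorial : ℂ) ≠ 0 := by exact_mod_cast j.factorial_ne_zero
    have h' : (j : ℂ) + 1 ≠ 0 := by exact_mod_cast j.succ_ne_zero
    rw [Nat.factorial_succ]
    simp only [id, Nat.add_sub_cancel]
    push_cast
    field_simp
  refine HasDerivAt.congr_deriv (h1.mul (hasDerivAt_cexp_ofReal_mul (-(Complex.I * lam)) x)) ?_
  simp only [expTaylor]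
  ring

/-- The chain of root functions, without the boundary condition at `π`. -/
noncomputable def rootChain (k : ℝ → ℝ → ℂ) (lam : ℂ) (j : ℕ) : Icc (0 : ℝ) π → ℂ :=
  fun x => transform k (expTaylor lam j) x

theorem extendIcc_rootChain_pi (k : ℝ → ℝ → ℂ) (lam : ℂ) (j : ℕ) :
    extendIcc (rootChain k lam j) π = transform k (expTaylor lam j) π :=
  extendIcc_restrict _ ⟨pi_pos.le, le_rfl⟩

theorem extendIcc_rootChain_zero (k : ℝ → ℝ → ℂ) (lam : ℂ) (j : ℕ) :
    extendIcc (rootChain k lam j) 0 = if j = 0 then 1 else 0 := by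
  have : extendIcc (rootChain k lam j) 0 = transform k (expTaylor lam j) 0 :=
    extendIcc_restrict _ ⟨le_rfl, pi_pos.le⟩
  rw [this]
  rcases j with _ | j <;> simp [transform, expTaylor]

theorem extendIcc_sum_smul (m : ℕ) (c : ℕ → ℂ) (y : ℕ → Icc (0 : ℝ) π → ℂ) (x : ℝ) :
    extendIcc (∑ i ∈ Finset.range m, c i • y i) x =
      ∑ i ∈ Finset.range m, c i * extendIcc (y i) x := by
  simp only [extendIcc, IccExtend, Function.comp_apply, Finset.sum_apply, Pi.smul_apply,
    smul_eq_mul]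

theorem ellEq_rootChain_zero {M k G : ℝ → ℝ → ℂ}
    (hM : ContinuousOn (fun q : ℝ × ℝ => M q.1 q.2) triangle)
    (hk : IsTransformationKernel (lagKernel M) k G) (lam : ℂ) :
    EllEq M (rootChain k lam 0) (lam • rootChain k lam 0) := by
  have h := ellEq_transform hM hk (φ := expTaylor lam 0) (χ := fun _ => 0) (lam := lam)
    continuous_const fun x => by simpa using hasDerivAt_expTaylor_zero lam x
  have h0 : (fun x : Icc (0 : ℝ) π => transform k (fun _ => 0) x) = 0 := by
    ext x; simp [transform]
  rwa [h0, add_zero] at h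

theorem ellEq_rootChain_succ {M k G : ℝ → ℝ → ℂ}
    (hM : ContinuousOn (fun q : ℝ × ℝ => M q.1 q.2) triangle)
    (hk : IsTransformationKernel (lagKernel M) k G) (lam : ℂ)
    (j : ℕ) :
    EllEq M (rootChain k lam (j + 1)) (lam • rootChain k lam (j + 1) + rootChain k lam j) :=
  ellEq_transform hM hk (continuous_expTaylor lam j) (hasDerivAt_expTaylor_succ lam j)

theorem ellEq_sum_rootChain {M k G : ℝ → ℝ → ℂ}
    (hM : ContinuousOn (fun q : ℝ × ℝ => M q.1 q.2) triangle)
    (hk : IsTransformationKernel (lagKernel M) k G) (lam : ℂ)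
    (m : ℕ) (c : ℕ → ℂ) :
    EllEq M (∑ i ∈ Finset.range (m + 1), c i • rootChain k lam i)
      (lam • (∑ i ∈ Finset.range (m + 1), c i • rootChain k lam i) +
        ∑ i ∈ Finset.range m, c (i + 1) • rootChain k lam i) := by
  induction m with
  | zero =>
    have := (ellEq_rootChain_zero hM hk lam).smul (c 0)
    rw [smul_comm] at this
    simpa using this
  | succ m ih =>
    have := ih.add hM ((ellEq_rootChain_succ hM hk lam m).smul (c (m + 1)))
    rw [Finset.sum_range_succ _ (m + 1)]
    convert this using 1
    rw [Finset.sum_range_succ (fun i => c (i + 1) • rootChain k lam i) m,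
      smul_add (c (m + 1)), smul_add lam, smul_comm lam (c (m + 1))]
    abel

/-- At `x = 0` only the member of index `0` is nonzero, so `c 0 = 0`. Applying `ℓ - lam` lowers
every index by one, and the induction continues. -/
theorem eq_zero_of_sum_rootChain {M k G : ℝ → ℝ → ℂ}
    (hM : ContinuousOn (fun q : ℝ × ℝ => M q.1 q.2) triangle)
    (hk : IsTransformationKernel (lagKernel M) k G) (lam : ℂ)
    (m : ℕ) (c : ℕ → ℂ)
    (h : ∑ i ∈ Finset.range m, c i • rootChain k lam i = 0) : ∀ i < m, c i = 0 := by
  induction m generalizing c with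
  | zero => simp
  | succ m ih =>
    have h0 : c 0 = 0 := by
      have := congrArg (fun y => extendIcc y 0) h
      rw [Finset.sum_range_succ'] at this
      have hs : extendIcc (∑ i ∈ Finset.range m, c (i + 1) • rootChain k lam (i + 1)) 0 = 0 := by
        rw [extendIcc_sum_smul]
        refine Finset.sum_eq_zero fun i _ => ?_
        rw [extendIcc_rootChain_zero]
        simp
      rw [extendIcc_add, Pi.add_apply, hs, extendIcc_smul, Pi.smul_apply,
        extendIcc_rootChain_zero] at this
      simpa [extendIcc_zero] using this
    have h1 := ellEq_sum_rootChain hM hk lam m c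
    rw [h, smul_zero, zero_add] at h1
    have h2 : EllEq M 0 0 := by
      have := h1.smul 0
      rwa [zero_smul, zero_smul] at this
    have h3 := ih (fun i => c (i + 1)) (h1.unique h2)
    intro i hi
    rcases i with _ | i
    · exact h0
    · exact h3 i (by omega)

theorem linearIndependent_rootChain {M k G : ℝ → ℝ → ℂ}
    (hM : ContinuousOn (fun q : ℝ × ℝ => M q.1 q.2) triangle)
    (hk : IsTransformationKernel (lagKernel M) k G) (lam : ℂ)
    (m : ℕ) :
    LinearIndependent ℂ fun i : Fin m => rootChain k lam i := by
  rw [Fintype.linearIndependent_iff]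
  intro g hg i
  have := eq_zero_of_sum_rootChain hM hk lam m (fun j => if h : j < m then g ⟨j, h⟩ else 0) (by
    rw [← hg, Finset.sum_range]
    simp) i i.2
  simpa using this

theorem isRootFunction_rootChain {M k G : ℝ → ℝ → ℂ}
    (hM : ContinuousOn (fun q : ℝ × ℝ => M q.1 q.2) triangle)
    (hk : IsTransformationKernel (lagKernel M) k G) (lam : ℂ)
    {m : ℕ} (h0 : ∀ j < m, transform k (expTaylor lam j) π = 0) :
    ∀ j < m, IsRootFunction M lam (j + 1) (rootChain k lam j) := by
  intro j
  induction j with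
  | zero =>
    intro hj
    exact ⟨(extendIcc_rootChain_pi k lam 0).trans (h0 0 hj), 0,
      by simpa using ellEq_rootChain_zero hM hk lam, rfl⟩
  | succ j ih =>
    intro hj
    exact ⟨(extendIcc_rootChain_pi k lam _).trans (h0 _ hj), _,
      ellEq_rootChain_succ hM hk lam j, ih (by omega)⟩

/-- By induction `g` is a combination of chain members. Raising its indices by one and adding `y(0)`
times the member of index `0` gives a function with the same image under `ℓ - lam` and the same
value at `0`, hence `y` itself. At `π` all members below index `m` vanish and the one of index `m`
does not, so `y(π) = 0` removes the latter. -/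
theorem IsRootFunction.eq_sum {M k G : ℝ → ℝ → ℂ}
    (hM : ContinuousOn (fun q : ℝ × ℝ => M q.1 q.2) triangle)
    (hk : IsTransformationKernel (lagKernel M) k G) (lam : ℂ)
    {m : ℕ} (h0 : ∀ j < m, transform k (expTaylor lam j) π = 0)
    (hm : transform k (expTaylor lam m) π ≠ 0) (l : ℕ) (y : Icc (0 : ℝ) π → ℂ)
    (hy : IsRootFunction M lam l y) :
    ∃ c : ℕ → ℂ, y = ∑ i ∈ Finset.range m, c i • rootChain k lam i := by
  induction l generalizing y with
  | zero => exact ⟨0, by rw [show y = 0 from hy]; simp⟩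
  | succ l ih =>
    obtain ⟨hπ, g, hg, hgl⟩ := hy
    obtain ⟨c, rfl⟩ := ih g hgl
    set a : ℕ → ℂ := fun i => Nat.casesOn i (extendIcc y 0) c with ha
    have hsum := ellEq_sum_rootChain hM hk lam m a
    have hdiff : EllEq M (y + (-1 : ℂ) • ∑ i ∈ Finset.range (m + 1), a i • rootChain k lam i)
        (lam • (y + (-1 : ℂ) • ∑ i ∈ Finset.range (m + 1), a i • rootChain k lam i)) := by
      convert hg.add hM (hsum.smul (-1)) using 1
      simp only [ha, smul_add, neg_smul, one_smul, smul_neg]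
      abel
    have hzero := hdiff.eq_zero hM (by
      rw [extendIcc_add, extendIcc_smul, Pi.add_apply, Pi.smul_apply, extendIcc_sum_smul,
        Finset.sum_range_succ']
      simp [extendIcc_rootChain_zero, ha])
    have hyeq : y = ∑ i ∈ Finset.range (m + 1), a i • rootChain k lam i := by
      rw [neg_one_smul, ← sub_eq_add_neg, sub_eq_zero] at hzero
      exact hzero
    have ham : a m = 0 := by
      rw [hyeq, extendIcc_sum_smul, Finset.sum_range_succ, Finset.sum_eq_zero, zero_add,
        extendIcc_rootChain_pi] at hπ
      · exact (mul_eq_zero.1 hπ).resolve_right hm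
      · intro i hi
        rw [extendIcc_rootChain_pi, h0 i (Finset.mem_range.1 hi), mul_zero]
    refine ⟨a, ?_⟩
    rw [hyeq, Finset.sum_range_succ, ham, zero_smul, add_zero]

/-- The algebraic multiplicity of `lam` is the order of the zero of the characteristic function. -/
theorem eigenvalueMultiplicity_eq {M k G : ℝ → ℝ → ℂ}
    (hM : ContinuousOn (fun q : ℝ × ℝ => M q.1 q.2) triangle)
    (hk : IsTransformationKernel (lagKernel M) k G) (lam : ℂ)
    {m : ℕ} (h0 : ∀ j < m, transform k (expTaylor lam j) π = 0)
    (hm : transform k (expTaylor lam m) π ≠ 0) : eigenvalueMultiplicity M lam = m := by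
  have hspan : rootSpace M lam =
      Submodule.span ℂ (range fun i : Fin m => rootChain k lam i) := by
    apply le_antisymm
    · refine Submodule.span_le.2 ?_
      rintro y ⟨l, hl⟩
      obtain ⟨c, rfl⟩ := IsRootFunction.eq_sum hM hk lam h0 hm l y hl
      exact Submodule.sum_mem _ fun i hi => Submodule.smul_mem _ _
        (Submodule.subset_span ⟨⟨i, Finset.mem_range.1 hi⟩, rfl⟩)
    · refine Submodule.span_mono ?_
      rintro _ ⟨i, rfl⟩
      exact ⟨i + 1, isRootFunction_rootChain hM hk lam h0 i i.2⟩
  have hli := linearIndependent_rootChain hM hk lam m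
  rw [eigenvalueMultiplicity, hspan, rank_span hli, Cardinal.mk_range_eq _ hli.injective,
    Cardinal.mk_fin]

/-! ### The characteristic function: derivatives, growth, asymptotics. -/

theorem hasDerivAt_expTaylor_param (lam : ℂ) (j : ℕ) (x : ℝ) :
    HasDerivAt (fun lam => expTaylor lam j x) ((j + 1) * expTaylor lam (j + 1) x) lam := by
  have h1 : HasDerivAt (fun lam : ℂ => Complex.exp (-(Complex.I * lam) * x))
      (Complex.exp (-(Complex.I * lam) * x) * (-(Complex.I * 1) * x)) lam :=
    ((((hasDerivAt_id lam).const_mul Complex.I).neg).mul_const (x : ℂ)).cexp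
  refine (h1.const_mul ((-Complex.I * x) ^ j / j.factorial : ℂ)).congr_deriv ?_
  have : (j.factorial : ℂ) ≠ 0 := by exact_mod_cast j.factorial_ne_zero
  have h' : (j : ℂ) + 1 ≠ 0 := by exact_mod_cast j.succ_ne_zero
  rw [expTaylor, Nat.factorial_succ]
  push_cast
  field_simp
  ring

theorem continuous_expTaylor_uncurry (j : ℕ) :
    Continuous fun q : ℂ × ℝ => expTaylor q.1 j q.2 := by
  unfold expTaylor; fun_prop

theorem hasDerivAt_transform_expTaylor {k : ℝ → ℝ → ℂ} (hk : Continuous k.uncurry) (j : ℕ)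
    (lam : ℂ) :
    HasDerivAt (fun lam => transform k (expTaylor lam j) π)
      ((j + 1) * transform k (expTaylor lam (j + 1)) π) lam := by
  have hkc : Continuous fun s => k π s := continuous_uncurry_comp₂ hk continuous_const continuous_id
  have hF : ∀ j, Continuous fun q : ℂ × ℝ => k π q.2 * expTaylor q.1 j (π - q.2) := fun j =>
    (hkc.comp continuous_snd).mul ((continuous_expTaylor_uncurry j).comp
      (f := fun q : ℂ × ℝ => (q.1, π - q.2)) (by fun_prop))
  have hF' : ∀ j lam, Continuous fun s => k π s * expTaylor lam j (π - s) := fun j lam =>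
    (hF j).comp (f := fun s => (lam, s)) (by fun_prop)
  obtain ⟨C, hC⟩ := ((isCompact_closedBall lam 1).prod (isCompact_Icc (a := 0)
    (b := π))).exists_bound_of_continuousOn (hF (j + 1)).continuousOn
  have h := intervalIntegral.hasDerivAt_integral_of_dominated_loc_of_deriv_le
    (μ := MeasureTheory.volume) (a := 0) (b := π) (x₀ := lam) (s := Metric.closedBall lam 1)
    (F := fun lam s => k π s * expTaylor lam j (π - s))
    (F' := fun lam s => (j + 1) * (k π s * expTaylor lam (j + 1) (π - s)))
    (bound := fun _ => (j + 1) * C) (Metric.closedBall_mem_nhds _ one_pos)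
    (Eventually.of_forall fun lam => (hF' j lam).aestronglyMeasurable)
    ((hF' j lam).intervalIntegrable _ _)
    (continuous_const.mul (hF' (j + 1) lam)).aestronglyMeasurable
    (Eventually.of_forall fun s hs z hz => by
      rw [uIoc_of_le pi_pos.le] at hs
      rw [norm_mul]
      have h1 := hC (z, s) ⟨hz, hs.1.le, hs.2⟩
      have h2 : ‖((j : ℂ) + 1)‖ = j + 1 := by
        rw [← Nat.cast_succ, Complex.norm_natCast]; push_cast; rfl
      rw [h2]
      gcongr)
    intervalIntegrable_const
    (Eventually.of_forall fun s _ z _ =>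
      ((hasDerivAt_expTaylor_param z j (π - s)).const_mul (k π s)).congr_deriv (by ring) |>
        fun h => by simpa using h)
  refine ((hasDerivAt_expTaylor_param lam j π).add h.2).congr_deriv ?_
  rw [transform, intervalIntegral.integral_const_mul, mul_add]

theorem iteratedDeriv_charFun {k : ℝ → ℝ → ℂ} (hk : Continuous k.uncurry) (j : ℕ) :
    iteratedDeriv j (fun lam => transform k (expTaylor lam 0) π) =
      fun lam => j.factorial * transform k (expTaylor lam j) π := by
  induction j with
  | zero => ext; simp
  | succ j ih =>
    rw [iteratedDeriv_succ, ih]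
    ext lam
    rw [((hasDerivAt_transform_expTaylor hk j lam).const_mul _).deriv, Nat.factorial_succ]
    push_cast
    ring

theorem norm_expTaylor_zero_le (lam : ℂ) {x : ℝ} (h0 : 0 ≤ x) (hx : x ≤ π) :
    ‖expTaylor lam 0 x‖ ≤ rexp (π * ‖lam‖) := by
  simp only [expTaylor, pow_zero, Nat.factorial_zero, Nat.cast_one, div_one, one_mul,
    Complex.norm_exp]
  gcongr
  refine (Complex.re_le_norm _).trans ?_
  rw [norm_mul, norm_neg, norm_mul, Complex.norm_I, one_mul, Complex.norm_real,
    Real.norm_of_nonneg h0, mul_comm]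
  gcongr

/-- The freedom in `B` allows one common bound for two characteristic functions. -/
theorem exists_charFun_growth {k : ℝ → ℝ → ℂ} (hk : Continuous k.uncurry) :
    ∃ A, 0 ≤ A ∧ ∀ B, A ≤ B → ∀ lam, ‖transform k (expTaylor lam 0) π‖ ≤ rexp (B * ‖lam‖ + B) := by
  have hkc : Continuous fun s => k π s := continuous_uncurry_comp₂ hk continuous_const continuous_id
  obtain ⟨C, hC⟩ := (isCompact_Icc (a := 0) (b := π)).exists_bound_of_continuousOn
    hkc.continuousOn
  have hC0 : 0 ≤ C := (norm_nonneg _).trans (hC 0 ⟨le_rfl, pi_pos.le⟩)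
  refine ⟨π + C * π, by positivity, fun B hB lam => ?_⟩
  have h1 : ‖∫ s in (0 : ℝ)..π, k π s * expTaylor lam 0 (π - s)‖ ≤
      C * rexp (π * ‖lam‖) * |π - 0| := by
    refine intervalIntegral.norm_integral_le_of_norm_le_const fun s hs => ?_
    rw [uIoc_of_le pi_pos.le] at hs
    rw [norm_mul]
    exact mul_le_mul (hC s ⟨hs.1.le, hs.2⟩)
      (norm_expTaylor_zero_le lam (by linarith [hs.2]) (by linarith [hs.1])) (norm_nonneg _) hC0
  rw [sub_zero, abs_of_pos pi_pos] at h1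
  calc ‖transform k (expTaylor lam 0) π‖
      ≤ rexp (π * ‖lam‖) + C * rexp (π * ‖lam‖) * π :=
        (norm_add_le _ _).trans
          (add_le_add (norm_expTaylor_zero_le lam pi_pos.le le_rfl) h1)
    _ = (C * π + 1) * rexp (π * ‖lam‖) := by ring
    _ ≤ rexp (C * π) * rexp (π * ‖lam‖) := by
        gcongr
        exact Real.add_one_le_exp _
    _ ≤ rexp (B * ‖lam‖ + B) := by
        rw [← Real.exp_add, Real.exp_le_exp]
        have := norm_nonneg lam
        have h2 : π * ‖lam‖ ≤ B * ‖lam‖ := by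
          gcongr
          have : 0 ≤ C * π := by positivity
          linarith
        linarith [pi_pos]

/-- At `λ = iτ` the leading exponential is exactly `exp(τπ)`, and the integral is smaller by a
factor `O(1/τ)`. This fixes the normalization that the zeros leave open. -/
theorem tendsto_charFun_mul_exp {k : ℝ → ℝ → ℂ} (hk : Continuous k.uncurry) :
    Tendsto (fun τ : ℝ => transform k (expTaylor (Complex.I * τ) 0) π * rexp (-(τ * π)))
      atTop (𝓝 1) := by
  have hkc : Continuous fun s => k π s := continuous_uncurry_comp₂ hk continuous_const continuous_id
  obtain ⟨C, hC⟩ := (isCompact_Icc (a := 0) (b := π)).exists_bound_of_continuousOn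
    hkc.continuousOn
  have hC0 : 0 ≤ C := (norm_nonneg _).trans (hC 0 ⟨le_rfl, pi_pos.le⟩)
  have hexp : ∀ τ x : ℝ, expTaylor (Complex.I * τ) 0 x = rexp (τ * x) := by
    intro τ x
    simp only [expTaylor, pow_zero, Nat.factorial_zero, Nat.cast_one, div_one, one_mul]
    rw [← mul_assoc, Complex.I_mul_I]
    push_cast
    ring_nf
  rw [tendsto_iff_norm_sub_tendsto_zero]
  refine squeeze_zero' (Eventually.of_forall fun _ => norm_nonneg _)
    ((eventually_gt_atTop 0).mono fun τ hτ => ?_) (tendsto_const_nhds.div_atTop tendsto_id :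
      Tendsto (fun τ : ℝ => C / τ) atTop (𝓝 0))
  have h1 : ‖∫ s in (0 : ℝ)..π, k π s * expTaylor (Complex.I * τ) 0 (π - s)‖ ≤
      C * rexp (τ * π) / τ := by
    have := intervalIntegral.integral_comp_sub_left (a := 0) (b := π)
      (fun r => k π (π - r) * expTaylor (Complex.I * τ) 0 r) π
    simp only [sub_sub_cancel, sub_self, sub_zero] at this
    rw [this]
    refine norm_integral_le_exp_mul pi_pos.le hτ hC0 fun r h0 hr => ?_
    rw [norm_mul, hexp, Complex.norm_real, Real.norm_of_nonneg (Real.exp_pos _).le]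
    gcongr
    exact hC _ ⟨by linarith, by linarith⟩
  have h2 : transform k (expTaylor (Complex.I * τ) 0) π * rexp (-(τ * π)) - 1 =
      (∫ s in (0 : ℝ)..π, k π s * expTaylor (Complex.I * τ) 0 (π - s)) * rexp (-(τ * π)) := by
    rw [transform, hexp, add_mul, ← Complex.ofReal_mul, ← Real.exp_add]
    simp
  rw [h2, norm_mul, Complex.norm_real, Real.norm_of_nonneg (Real.exp_pos _).le]
  calc _ ≤ C * rexp (τ * π) / τ * rexp (-(τ * π)) := by gcongr
    _ = C / τ * (rexp (τ * π) * rexp (-(τ * π))) := by ring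
    _ = C / τ := by rw [← Real.exp_add]; simp

/-! ### The characteristic function determines the kernel at `x = π`. -/

/-- A continuous function on `[0, π]` is determined by its Fourier–Laplace transform. -/
theorem eq_zero_of_integral_mul_exp {f : ℝ → ℂ} (hf : Continuous f)
    (h : ∀ lam : ℂ, ∫ s in (0 : ℝ)..π, f s * Complex.exp (Complex.I * lam * s) = 0) :
    ∀ s ∈ Icc 0 π, f s = 0 := by
  have hc : ∀ n, fourierCoeffOn pi_pos f n = 0 := by
    intro n
    rw [fourierCoeffOn_eq_integral]
    have : ∫ x in (0 : ℝ)..π, fourier (-n) (x : AddCircle (π - 0)) • f x = 0 := by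
      -- On an interval of length `π` the Fourier modes are `exp(-2ins)`, so the transform is needed
      -- only at `λ = -2n`.
      rw [← h (-2 * n)]
      refine intervalIntegral.integral_congr fun s _ => ?_
      simp only [fourier_coe_apply, smul_eq_mul]
      rw [mul_comm]
      congr 2
      have : (π : ℂ) ≠ 0 := by exact_mod_cast pi_ne_zero
      push_cast
      field_simp
      ring
    rw [this, smul_zero]
  have hL2 : MeasureTheory.MemLp f 2 (MeasureTheory.volume.restrict (Ioc 0 π)) := by
    obtain ⟨C, hC⟩ := (isCompact_Icc (a := 0) (b := π)).exists_bound_of_continuousOn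
      hf.continuousOn
    refine MeasureTheory.MemLp.of_bound hf.aestronglyMeasurable C ?_
    filter_upwards [MeasureTheory.ae_restrict_mem measurableSet_Ioc] with x hx
    exact hC x ⟨hx.1.le, hx.2⟩
  have hp := tsum_sq_fourierCoeffOn pi_pos hL2
  simp only [hc, norm_zero, ne_eq, OfNat.ofNat_ne_zero, not_false_eq_true, zero_pow, tsum_zero,
    sub_zero, smul_eq_mul] at hp
  intro s hs
  by_contra hne
  have hpos := intervalIntegral.integral_pos pi_pos (f := fun x => ‖f x‖ ^ 2)
    (by fun_prop) (fun x _ => by positivity) ⟨s, hs, by positivity⟩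
  have : 0 < π⁻¹ * ∫ x in (0 : ℝ)..π, ‖f x‖ ^ 2 := mul_pos (by positivity) hpos
  linarith

theorem kernel_eq_of_charFun_eq {k k' : ℝ → ℝ → ℂ} (hk : Continuous k.uncurry)
    (hk' : Continuous k'.uncurry)
    (h : ∀ lam, transform k (expTaylor lam 0) π = transform k' (expTaylor lam 0) π) :
    ∀ s ∈ Icc 0 π, k π s = k' π s := by
  have hkc : Continuous fun s => k π s := continuous_uncurry_comp₂ hk continuous_const continuous_id
  have hkc' : Continuous fun s => k' π s :=
    continuous_uncurry_comp₂ hk' continuous_const continuous_id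
  have key := eq_zero_of_integral_mul_exp (f := fun s => k π s - k' π s) (hkc.sub hkc')
    fun lam => by
    have h1 := h lam
    rw [transform, transform, add_right_inj] at h1
    have h2 : ∀ s : ℝ, (k π s - k' π s) * Complex.exp (Complex.I * lam * s) =
        Complex.exp (Complex.I * lam * π) * (k π s * expTaylor lam 0 (π - s) -
          k' π s * expTaylor lam 0 (π - s)) := by
      intro s
      have : Complex.exp (Complex.I * lam * s) =
          Complex.exp (Complex.I * lam * π) * expTaylor lam 0 (π - s) := by
        simp only [expTaylor, pow_zero, Nat.factorial_zero, Nat.cast_one, div_one, one_mul]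
        rw [← Complex.exp_add]
        push_cast
        ring_nf
      rw [this]; ring
    simp only [h2]
    rw [intervalIntegral.integral_const_mul, intervalIntegral.integral_sub, h1, sub_self, mul_zero]
    · exact (hkc.mul (by fun_prop)).intervalIntegrable _ _
    · exact (hkc'.mul (by fun_prop)).intervalIntegrable _ _
  exact fun s hs => sub_eq_zero.1 (key s hs)

/-! ### Entire functions of exponential type with the same zeros. -/

/-- The meromorphic quotient has order `0` everywhere, so its normal form is analytic and zero-free.
The product identity holds off isolated points and extends by continuity. -/
theorem exists_entire_quotient {f g : ℂ → ℂ} (hf : Differentiable ℂ f) (hg : Differentiable ℂ g)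
    (hord : ∀ z, analyticOrderAt f z = analyticOrderAt g z)
    (hne : ∀ z, analyticOrderAt g z ≠ ⊤) :
    ∃ F : ℂ → ℂ, Differentiable ℂ F ∧ (∀ z, F z ≠ 0) ∧ (∀ z, f z = F z * g z) ∧
      F =ᶠ[codiscrete ℂ] f * g⁻¹ := by
  have hfm : Meromorphic f := fun z => (hf.analyticAt z).meromorphicAt
  have hgm : Meromorphic g := fun z => (hg.analyticAt z).meromorphicAt
  have hq : MeromorphicOn (f * g⁻¹) univ := fun z _ => (hfm z).mul (hgm z).inv
  have hq0 : ∀ z, meromorphicOrderAt (f * g⁻¹) z = 0 := by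
    intro z
    rw [meromorphicOrderAt_mul (hfm z) (hgm z).inv, meromorphicOrderAt_inv,
      (hf.analyticAt z).meromorphicOrderAt_eq, (hg.analyticAt z).meromorphicOrderAt_eq, hord z]
    obtain ⟨m, hm⟩ := ENat.ne_top_iff_exists.1 (hne z)
    rw [← hm, ENat.map_natCast, ← WithTop.LinearOrderedAddCommGroup.coe_neg, ← WithTop.coe_add,
      add_neg_cancel, WithTop.coe_zero]
  set F := toMeromorphicNFOn (f * g⁻¹) univ with hF
  have hNF : ∀ z, MeromorphicNFAt F z := fun z =>
    meromorphicNFOn_toMeromorphicNFOn (f * g⁻¹) univ (mem_univ z)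
  have hF0 : ∀ z, meromorphicOrderAt F z = 0 := fun z => by
    rw [hF, meromorphicOrderAt_toMeromorphicNFOn hq (mem_univ z), hq0]
  have hFa : ∀ z, AnalyticAt ℂ F z := fun z =>
    (hNF z).meromorphicOrderAt_nonneg_iff_analyticAt.1 (hF0 z).ge
  have hFe : F =ᶠ[codiscrete ℂ] f * g⁻¹ := (toMeromorphicNFOn_eqOn_codiscrete hq).symm
  refine ⟨F, fun z => (hFa z).differentiableAt,
    fun z => (hNF z).meromorphicOrderAt_eq_zero_iff.1 (hF0 z), fun z => ?_, hFe⟩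
  have h1 : F =ᶠ[𝓝[≠] z] f * g⁻¹ := hq.toMeromorphicNFOn_eq_self_on_nhdsNE (mem_univ z)
  have h2 : ∀ᶠ w in 𝓝[≠] z, g w ≠ 0 := by
    rcases (hg.analyticAt z).eventually_eq_zero_or_eventually_ne_zero with h | h
    · exact absurd (analyticOrderAt_eq_top.2 h) (hne z)
    · exact h
  have h3 : f =ᶠ[𝓝[≠] z] fun w => F w * g w := by
    filter_upwards [h1, h2] with w hw hw'
    rw [hw]
    simp [hw']
  have h4 : Tendsto f (𝓝[≠] z) (𝓝 (f z)) := hf.continuous.continuousAt.mono_left nhdsWithin_le_nhds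
  have h5 : Tendsto (fun w => F w * g w) (𝓝[≠] z) (𝓝 (F z * g z)) :=
    ((hFa z).continuousAt.mul hg.continuous.continuousAt).mono_left nhdsWithin_le_nhds
  exact tendsto_nhds_unique (h4.congr' h3) h5

theorem exists_entire_log {F : ℂ → ℂ} (hF : Differentiable ℂ F) (hF0 : ∀ z, F z ≠ 0) :
    ∃ h : ℂ → ℂ, Differentiable ℂ h ∧ ∀ z, F z = Complex.exp (h z) := by
  have hd : Differentiable ℂ fun z => deriv F z / F z :=
    (hF.deriv).div hF hF0
  obtain ⟨h, h0, hh⟩ := hd.isExactOn_univ.with_val_at 0 (Complex.log (F 0))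
  have hh' : ∀ z, HasDerivAt h (deriv F z / F z) z := fun z => hh z (mem_univ z)
  refine ⟨h, fun z => (hh' z).differentiableAt, fun z => ?_⟩
  have hc : ∀ z, HasDerivAt (fun z => F z * Complex.exp (-h z)) 0 z := by
    intro z
    refine ((hF z).hasDerivAt.mul (hh' z).neg.cexp).congr_deriv ?_
    have := hF0 z
    field_simp
    ring
  have := is_const_of_deriv_eq_zero (fun z => (hc z).differentiableAt) (fun z => (hc z).deriv) z 0
  rw [h0, Complex.exp_neg, Complex.exp_neg, Complex.exp_log (hF0 0),
    mul_inv_cancel₀ (hF0 0)] at this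
  exact eq_of_mul_inv_eq_one this

/-- An entire function whose real part grows at most linearly is affine. -/
theorem affine_of_re_le {h : ℂ → ℂ} (hh : Differentiable ℂ h) {A B : ℝ} (hA : 0 ≤ A) (hB : 0 < B)
    (hre : ∀ z, (h z).re ≤ A * ‖z‖ + B) : ∃ a b : ℂ, ∀ z, h z = a * z + b := by
  have h1 : ∀ z, ‖h z‖ ≤ (4 * A) * ‖z‖ + (4 * A + 2 * B + 3 * ‖h 0‖) := by
    intro z
    -- Borel–Carathéodory on radius `2R`: since `‖z‖ < R`, the factors `‖z‖ / (2R - ‖z‖)` and `(2R +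
    -- ‖z‖) / (2R - ‖z‖)` are at most `1` and `3`.
    set R := ‖z‖ + 1 with hR
    have hz := norm_nonneg z
    have hbc := Complex.borelCaratheodory (f := h) (M := A * (2 * R) + B) (R := 2 * R) (z := z)
      (by positivity) hh.differentiableOn (fun w hw => by
        have : ‖w‖ < 2 * R := by simpa using hw
        have h3 := hre w
        have h4 : A * ‖w‖ ≤ A * (2 * R) := by gcongr
        simp only [mem_ofPred_eq]
        linarith) (by positivity) (by simp; linarith)
    have hd : 0 < 2 * R - ‖z‖ := by linarith
    have e1 : 2 * (A * (2 * R) + B) * ‖z‖ / (2 * R - ‖z‖) ≤ 2 * (A * (2 * R) + B) := by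
      rw [div_le_iff₀ hd]
      have : 0 ≤ 2 * (A * (2 * R) + B) := by positivity
      nlinarith
    have e2 : ‖h 0‖ * (2 * R + ‖z‖) / (2 * R - ‖z‖) ≤ 3 * ‖h 0‖ := by
      rw [div_le_iff₀ hd]
      have := norm_nonneg (h 0)
      nlinarith
    rw [hR] at e1 hbc e2
    linarith
  set D := 4 * A + 2 * B + 3 * ‖h 0‖ with hD
  have hD0 : 0 ≤ D := by positivity
  -- Cauchy's estimate on a circle of radius `‖c‖ + 1` turns linear growth into a bounded
  -- derivative, constant by Liouville's theorem.
  have h2 : ∀ c, ‖deriv h c‖ ≤ 8 * A + D := by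
    intro c
    have hc := norm_nonneg c
    have := Complex.norm_deriv_le_of_forall_mem_sphere_norm_le (f := h) (c := c) (R := ‖c‖ + 1)
      (C := (8 * A + D) * (‖c‖ + 1)) (by positivity) hh.diffContOnCl (fun z hz => by
        have h3 : ‖z - c‖ = ‖c‖ + 1 := by simpa [dist_eq_norm] using hz
        have h4 : ‖z‖ ≤ 2 * (‖c‖ + 1) := by
          have := norm_add_le (z - c) c
          rw [sub_add_cancel] at this
          linarith
        have h5 := h1 z
        have h6 : 4 * A * ‖z‖ ≤ 4 * A * (2 * (‖c‖ + 1)) := by gcongr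
        nlinarith)
    rwa [mul_div_cancel_right₀ _ (by positivity)] at this
  have h3 := hh.deriv.apply_eq_apply_of_bounded (isBounded_iff_forall_norm_le.2
    ⟨8 * A + D, by rintro _ ⟨c, rfl⟩; exact h2 c⟩)
  refine ⟨deriv h 0, h 0, fun z => ?_⟩
  have hc : ∀ z, HasDerivAt (fun z => h z - deriv h 0 * z) 0 z := by
    intro z
    refine ((hh z).hasDerivAt.sub ((hasDerivAt_id z).const_mul (deriv h 0))).congr_deriv ?_
    rw [h3 z 0]; ring
  have := is_const_of_deriv_eq_zero (fun z => (hc z).differentiableAt) (fun z => (hc z).deriv) z 0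
  simp only [mul_zero, sub_zero] at this
  linear_combination this

/-- Poisson's formula for `Re h = log ‖F‖ ≤ log⁺ ‖F‖`: for `2‖w‖ ≤ R` the kernel lies between `0`
and `(R + ‖w‖)/(R - ‖w‖) ≤ 3`. -/
theorem re_le_proximity {F h : ℂ → ℂ} (hh : Differentiable ℂ h)
    (hF : ∀ z, F z = Complex.exp (h z)) {R : ℝ} {w : ℂ} (hR : 0 < R) (hw : 2 * ‖w‖ ≤ R) :
    (h w).re ≤ 3 * ValueDistribution.proximity F ⊤ R := by
  have hFc : Continuous F := by
    have : F = fun z => Complex.exp (h z) := funext hF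
    rw [this]; exact Complex.continuous_exp.comp hh.continuous
  have hwR : w ∈ Metric.ball (0 : ℂ) R := by
    have := norm_nonneg w
    rw [mem_ball_zero_iff]
    rcases this.eq_or_lt with h | h <;> linarith
  have hharm : InnerProductSpace.HarmonicOnNhd (fun z => (h z).re) (Metric.closedBall 0 R) :=
    fun z _ => (hh.analyticAt z).harmonicAt_re
  have hP := hharm.circleAverage_re_herglotzRieszKernel_smul hwR
  rw [ValueDistribution.proximity_top, ← hP, ← smul_eq_mul, ← Real.circleAverage_smul]
  refine Real.circleAverage_mono ?_ ?_ ?_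
  · refine ContinuousOn.circleIntegrable hR.le ?_
    refine ContinuousOn.smul ?_ (Complex.continuous_re.comp hh.continuous).continuousOn
    exact Complex.continuous_re.comp_continuousOn
      (by simpa only [abs_of_pos hR] using continuousOn_herglotzRieszKernel_sphere hwR)
  · refine Continuous.continuousOn ?_ |>.circleIntegrable hR.le
    exact continuous_const.smul (Real.continuous_posLog.comp hFc.norm)
  · intro z hz
    rw [abs_of_pos hR] at hz
    have h1 := re_herglotzRieszKernel_le hz hwR
    have h2 := le_re_herglotzRieszKernel hz hwR
    rw [← herglotzRieszKernel_def] at h1 h2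
    have h3 : (h z).re ≤ log⁺ ‖F z‖ := by
      rw [hF z, Complex.norm_exp, Real.posLog, Real.log_exp]
      exact le_max_right _ _
    have hn := norm_nonneg w
    have hlt : ‖w‖ < R := by simpa using hwR
    rw [sub_zero] at h1 h2
    have h4 : (R + ‖w‖) / (R - ‖w‖) ≤ 3 := by
      rw [div_le_iff₀ (by linarith)]; linarith
    have h5 : 0 ≤ (R - ‖w‖) / (R + ‖w‖) := div_nonneg (by linarith) (by linarith)
    simp only [Pi.smul_apply', Function.comp_apply, smul_eq_mul, Pi.smul_apply]
    calc _ ≤ (herglotzRieszKernel 0 w z).re * log⁺ ‖F z‖ :=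
          mul_le_mul_of_nonneg_left h3 (h5.trans h2)
      _ ≤ 3 * log⁺ ‖F z‖ := mul_le_mul_of_nonneg_right (h1.trans h4) Real.posLog_nonneg

theorem characteristic_top_le_of_norm_le {f : ℂ → ℂ} (hf : Differentiable ℂ f) {A : ℝ}
    (hA : 0 ≤ A) (hfA : ∀ z, ‖f z‖ ≤ rexp (A * ‖z‖ + A)) {R : ℝ} (hR : 0 < R) :
    ValueDistribution.characteristic f ⊤ R ≤ A * R + A := by
  have hfa : AnalyticOnNhd ℂ f univ := fun z _ => hf.analyticAt z
  have h0 : ValueDistribution.logCounting f ⊤ = 0 := by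
    rw [ValueDistribution.logCounting_top,
      negPart_eq_zero.2 (MeromorphicOn.AnalyticOnNhd.divisor_nonneg hfa), map_zero]
  rw [ValueDistribution.characteristic, h0, add_zero, ValueDistribution.proximity_top]
  refine Real.circleAverage_mono_on_of_le_circle
    (Continuous.continuousOn (Real.continuous_posLog.comp hf.continuous.norm) |>.circleIntegrable
      hR.le) fun z hz => ?_
  rw [abs_of_pos hR, mem_sphere_zero_iff_norm] at hz
  have := Real.posLog_le_posLog (norm_nonneg _) (hfA z)
  rw [hz] at this
  refine this.trans (le_of_eq ?_)
  rw [Real.posLog, Real.log_exp, max_eq_right (by positivity)]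

/-- Two entire functions of exponential type with the same zeros, counted with multiplicities,
differ by the exponential of an affine function. -/
theorem eq_exp_affine_mul {f g : ℂ → ℂ} (hf : Differentiable ℂ f) (hg : Differentiable ℂ g)
    {A : ℝ} (hA : 0 ≤ A) (hfA : ∀ z, ‖f z‖ ≤ rexp (A * ‖z‖ + A))
    (hgA : ∀ z, ‖g z‖ ≤ rexp (A * ‖z‖ + A))
    (hord : ∀ z, analyticOrderAt f z = analyticOrderAt g z)
    (hne : ∀ z, analyticOrderAt g z ≠ ⊤) :
    ∃ a b : ℂ, ∀ z, f z = Complex.exp (a * z + b) * g z := by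
  obtain ⟨F, hF, hF0, hfF, hFe⟩ := exists_entire_quotient hf hg hord hne
  obtain ⟨h, hh, hFh⟩ := exists_entire_log hF hF0
  have hfm : Meromorphic f := fun z => (hf.analyticAt z).meromorphicAt
  have hgm : Meromorphic g := fun z => (hg.analyticAt z).meromorphicAt
  have hne' : ∀ (u : ℂ → ℂ) (_ : Differentiable ℂ u) z, analyticOrderAt u z ≠ ⊤ →
      meromorphicOrderAt u z ≠ ⊤ := fun u hu z hz => by
    rw [(hu.analyticAt z).meromorphicOrderAt_eq]
    simpa using hz
  set c := Real.log ‖meromorphicTrailingCoeffAt g 0‖ with hc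
  have hchar : ∀ R : ℝ, 1 ≤ R →
      ValueDistribution.proximity F ⊤ R ≤ 2 * (A * R + A) - c := by
    intro R hR
    have hR0 : R ≠ 0 := by positivity
    have h1 : ValueDistribution.proximity F ⊤ R ≤ ValueDistribution.characteristic F ⊤ R :=
      le_add_of_nonneg_right (ValueDistribution.logCounting_nonneg hR)
    rw [ValueDistribution.characteristic_congr_codiscrete hFe hR0] at h1
    have h2 := ValueDistribution.characteristic_mul_top_le hR hfm
      (fun z => hne' f hf z (by rw [hord]; exact hne z)) hgm.inv
      (fun z => by
        rw [meromorphicOrderAt_inv, ne_eq, LinearOrderedAddCommGroupWithTop.neg_eq_top]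
        exact hne' g hg z (hne z))
    -- By Jensen's formula the characteristics of `g` and `1/g` differ by the constant `c`. So `F =
    -- f/g` grows linearly in the mean without any lower bound on `‖g‖`.
    have h3 := ValueDistribution.characteristic_sub_characteristic_inv_of_ne_zero hgm hR0
    have h4 := characteristic_top_le_of_norm_le hf hA hfA (R := R) (by linarith)
    have h5 := characteristic_top_le_of_norm_le hg hA hgA (R := R) (by linarith)
    rw [Pi.add_apply] at h2
    linarith
  -- The constants come from `3 (2 (A R + A) - c)` at `R = 2‖z‖ + 1`; the final `1` makes `B`
  -- positive.
  obtain ⟨a, b, hab⟩ := affine_of_re_le hh (A := 12 * A) (B := 12 * A + 3 * |c| + 1)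
    (by positivity) (by positivity) fun z => by
      have hz := norm_nonneg z
      have h1 := re_le_proximity hh hFh (R := 2 * ‖z‖ + 1) (w := z) (by positivity) (by linarith)
      have h2 := hchar (2 * ‖z‖ + 1) (by linarith)
      have h3 := neg_abs_le c
      nlinarith
  exact ⟨a, b, fun z => by rw [hfF, hFh, hab]⟩

/-! ### The spectrum determines the characteristic function. -/

theorem differentiable_charFun {k : ℝ → ℝ → ℂ} (hk : Continuous k.uncurry) :
    Differentiable ℂ fun lam => transform k (expTaylor lam 0) π := fun lam =>
  (hasDerivAt_transform_expTaylor hk 0 lam).differentiableAt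

theorem analyticOrderAt_charFun_ne_top {k : ℝ → ℝ → ℂ} (hk : Continuous k.uncurry) (lam : ℂ) :
    analyticOrderAt (fun lam => transform k (expTaylor lam 0) π) lam ≠ ⊤ := by
  intro h
  have hd := differentiable_charFun hk
  have h1 := AnalyticOnNhd.eq_of_eventuallyEq (fun z _ => hd.analyticAt z)
    (fun z _ => analyticAt_const (v := (0 : ℂ))) (analyticOrderAt_eq_top.1 h)
  have h2 := tendsto_charFun_mul_exp hk
  have h3 : ∀ τ : ℝ, transform k (expTaylor (Complex.I * τ) 0) π = 0 := fun τ =>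
    congrFun h1 (Complex.I * τ)
  simp only [h3, zero_mul] at h2
  exact zero_ne_one (tendsto_nhds_unique tendsto_const_nhds h2)

theorem eigenvalueMultiplicity_eq_order {M k G : ℝ → ℝ → ℂ}
    (hM : ContinuousOn (fun q : ℝ × ℝ => M q.1 q.2) triangle)
    (hk : IsTransformationKernel (lagKernel M) k G) {lam : ℂ} {m : ℕ}
    (hm : analyticOrderAt (fun lam => transform k (expTaylor lam 0) π) lam = m) :
    eigenvalueMultiplicity M lam = m := by
  have hd := differentiable_charFun hk.continuous_kernel
  rw [analyticOrderAt_eq_nat_iff_iteratedDeriv_eq_zero (hd.analyticAt lam)] at hm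
  simp only [iteratedDeriv_charFun hk.continuous_kernel, mul_eq_zero, Nat.cast_eq_zero,
    Nat.factorial_ne_zero, false_or, ne_eq] at hm
  exact eigenvalueMultiplicity_eq hM hk lam hm.1 hm.2

/-- Dividing the limit at `τ + s` by the limit at `τ` gives `exp(ais) = 1` for all real `s`.
Differentiating at `s = 0` gives `a = 0`, and the limit is then `exp b`. -/
theorem eq_zero_of_tendsto_cexp {a b : ℂ}
    (h : Tendsto (fun τ : ℝ => Complex.exp (a * (Complex.I * τ) + b)) atTop (𝓝 1)) (z : ℂ) :
    Complex.exp (a * z + b) = 1 := by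
  have h1 : ∀ s : ℝ, Complex.exp (a * Complex.I * s) = 1 := by
    intro s
    have h2 : Tendsto (fun τ : ℝ => Complex.exp (a * (Complex.I * ((τ + s : ℝ) : ℂ)) + b)) atTop
        (𝓝 1) := h.comp (tendsto_atTop_add_const_right _ s tendsto_id)
    have h3 := h2.div h one_ne_zero
    rw [div_one] at h3
    refine tendsto_nhds_unique (tendsto_const_nhds.congr fun τ => ?_) h3
    rw [Pi.div_apply, ← Complex.exp_sub]
    congr 1
    push_cast
    ring
  have ha : a = 0 := by
    have h2 := hasDerivAt_cexp_ofReal_mul (a * Complex.I) 0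
    simp only [h1] at h2
    have := h2.unique (hasDerivAt_const (0 : ℝ) (1 : ℂ))
    simpa using this
  subst ha
  simp only [zero_mul, zero_add] at h ⊢
  exact tendsto_nhds_unique tendsto_const_nhds h

/-- The spectrum, with multiplicities, determines the characteristic function. -/
theorem charFun_eq_of_sameSpectrum {M N k k' G G' : ℝ → ℝ → ℂ}
    (hM : ContinuousOn (fun q : ℝ × ℝ => M q.1 q.2) triangle)
    (hN : ContinuousOn (fun q : ℝ × ℝ => N q.1 q.2) triangle)
    (hk : IsTransformationKernel (lagKernel M) k G)
    (hk' : IsTransformationKernel (lagKernel N) k' G') (h : SameSpectrum M N) (lam : ℂ) :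
    transform k (expTaylor lam 0) π = transform k' (expTaylor lam 0) π := by
  have hc := hk.continuous_kernel
  have hc' := hk'.continuous_kernel
  obtain ⟨A, hA0, hA⟩ := exists_charFun_growth hc
  obtain ⟨A', hA0', hA'⟩ := exists_charFun_growth hc'
  obtain ⟨a, b, hab⟩ := eq_exp_affine_mul (differentiable_charFun hc) (differentiable_charFun hc')
    (hA0.trans (le_max_left A A')) (hA _ (le_max_left _ _)) (hA' _ (le_max_right _ _))
    (fun z => by
      obtain ⟨m, hm⟩ := ENat.ne_top_iff_exists.1 (analyticOrderAt_charFun_ne_top hc z)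
      obtain ⟨m', hm'⟩ := ENat.ne_top_iff_exists.1 (analyticOrderAt_charFun_ne_top hc' z)
      have h1 := h z
      rw [eigenvalueMultiplicity_eq_order hM hk hm.symm,
        eigenvalueMultiplicity_eq_order hN hk' hm'.symm, Nat.cast_inj] at h1
      rw [← hm, ← hm', h1])
    (analyticOrderAt_charFun_ne_top hc')
  have h1 : Tendsto (fun τ : ℝ => Complex.exp (a * (Complex.I * τ) + b)) atTop (𝓝 1) := by
    have h2 := tendsto_charFun_mul_exp hc'
    have h3 := (tendsto_charFun_mul_exp hc).div h2 one_ne_zero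
    rw [div_one] at h3
    refine h3.congr' ?_
    filter_upwards [h2.eventually_ne one_ne_zero] with τ hτ
    rw [Pi.div_apply, hab, mul_assoc, mul_div_cancel_right₀ _ hτ]
  rw [hab, eq_zero_of_tendsto_cexp h1, one_mul]

/-! ### Recovering the unknown factor from the kernel at `x = π`. -/

theorem norm_integral_le_exp_mul_sub {F : ℝ → ℂ} {s β B : ℝ} (hs : 0 ≤ s) (hβ : 0 < β)
    (hB : 0 ≤ B) (hF : ∀ r, 0 ≤ r → r ≤ s → ‖F r‖ ≤ B * rexp (β * (s - r))) :
    ‖∫ r in (0 : ℝ)..s, F r‖ ≤ B * rexp (β * s) / β := by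
  have := intervalIntegral.integral_comp_sub_left (a := 0) (b := s) F s
  rw [sub_self, sub_zero] at this
  rw [← this]
  refine norm_integral_le_exp_mul hs hβ hB fun r h0 hr => ?_
  have := hF (s - r) (by linarith) (by linarith)
  rwa [sub_sub_cancel] at this

/-- Write `nk - n'k' = (n - n')k + n'(k - k')` in the convolution. The remainder is thus linear in
`p` and `k - k'` and involves only lags up to `s`; the weight supplies the factor `1/β`. -/
theorem norm_source_sub_le {n n' k k' G G' ρ : ℝ → ℝ → ℂ} {p : ℝ → ℂ} (hn : Continuous n.uncurry)
    (hn' : Continuous n'.uncurry) (hk : IsTransformationKernel n k G)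
    (hk' : IsTransformationKernel n' k' G')
    (hdiff : ∀ x s, 0 ≤ s → s ≤ x → x ≤ π → n x s - n' x s = ρ x s * p s)
    {Cρ Ck Cn β q m b : ℝ} (hβ : 0 < β) (hCρ0 : 0 ≤ Cρ) (hCk0 : 0 ≤ Ck) (hCn0 : 0 ≤ Cn)
    (hq0 : 0 ≤ q) (hm0 : 0 ≤ m)
    (hCρ : ∀ x s, 0 ≤ s → s ≤ x → x ≤ π → ‖ρ x s‖ ≤ Cρ)
    (hCk : ∀ x s, 0 ≤ s → s ≤ x → x ≤ π → ‖k x s‖ ≤ Ck)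
    (hCn : ∀ x s, 0 ≤ s → s ≤ x → x ≤ π → ‖n' x s‖ ≤ Cn)
    (hq : ∀ s, 0 ≤ s → s ≤ b → ‖p s‖ ≤ q * rexp (β * s))
    (hm : ∀ x s, 0 ≤ s → s ≤ b → s ≤ x → x ≤ π → ‖k x s - k' x s‖ ≤ m * rexp (β * s))
    {z s : ℝ} (hs : 0 ≤ s) (hsb : s ≤ b) (hsz : s ≤ z) (hz : z ≤ π) :
    ‖G z s - G' z s - ρ z s * p s‖ ≤ (Cρ * q * Ck + Cn * m) * rexp (β * s) / β := by
  have hc : ∀ u v : ℝ → ℝ → ℂ, Continuous u.uncurry → Continuous v.uncurry →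
      IntervalIntegrable (fun r => u z (s - r) * v (z - s + r) r) MeasureTheory.volume 0 s :=
    fun u v hu hv => ((continuous_uncurry_comp₂ hu (by fun_prop) (by fun_prop)).mul
      (continuous_uncurry_comp₂ hv (by fun_prop) (by fun_prop))).intervalIntegrable _ _
  have hkc := hk.continuous_kernel
  have hkc' := hk'.continuous_kernel
  have e : G z s - G' z s - ρ z s * p s =
      (∫ r in (0 : ℝ)..s, (n z (s - r) - n' z (s - r)) * k (z - s + r) r) +
      ∫ r in (0 : ℝ)..s, n' z (s - r) * (k (z - s + r) r - k' (z - s + r) r) := by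
    rw [← intervalIntegral.integral_add
      (hc (fun x s => n x s - n' x s) k (hn.sub hn') hkc)
      (hc n' (fun x s => k x s - k' x s) hn' (hkc.sub hkc')), hk.source_eq z s hs hsz hz,
      hk'.source_eq z s hs hsz hz, ← hdiff z s hs hsz hz, lagSource, lagSource]
    have : ∫ r in (0 : ℝ)..s, ((n z (s - r) - n' z (s - r)) * k (z - s + r) r +
        n' z (s - r) * (k (z - s + r) r - k' (z - s + r) r)) =
        ∫ r in (0 : ℝ)..s, (n z (s - r) * k (z - s + r) r - n' z (s - r) * k' (z - s + r) r) :=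
      intervalIntegral.integral_congr fun r _ => by ring
    rw [this, intervalIntegral.integral_sub (hc n k hn hkc) (hc n' k' hn' hkc')]
    ring
  have h1 : ‖∫ r in (0 : ℝ)..s, (n z (s - r) - n' z (s - r)) * k (z - s + r) r‖ ≤
      (Cρ * q * Ck) * rexp (β * s) / β := by
    refine norm_integral_le_exp_mul_sub hs hβ (by positivity) fun r h0 hr => ?_
    rw [hdiff z (s - r) (by linarith) (by linarith) hz, norm_mul, norm_mul]
    calc _ ≤ Cρ * (q * rexp (β * (s - r))) * Ck := by
          gcongr
          · exact hCρ _ _ (by linarith) (by linarith) hz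
          · exact hq _ (by linarith) (by linarith)
          · exact hCk _ _ h0 (by linarith) (by linarith)
      _ = _ := by ring
  have h2 : ‖∫ r in (0 : ℝ)..s, n' z (s - r) * (k (z - s + r) r - k' (z - s + r) r)‖ ≤
      (Cn * m) * rexp (β * s) / β := by
    refine norm_integral_le_exp_mul hs hβ (by positivity) fun r h0 hr => ?_
    rw [norm_mul]
    calc _ ≤ Cn * (m * rexp (β * r)) := by
          gcongr
          · exact hCn _ _ (by linarith) (by linarith) hz
          · exact hm _ _ h0 (by linarith) (by linarith) (by linarith)
      _ = _ := by ring
  rw [e]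
  refine (norm_add_le _ _).trans ((add_le_add h1 h2).trans (le_of_eq ?_))
  ring

/-- If the transformation kernels agree at `x = π` and the kernels differ by `ρ(x, s) p(s)`, then
`p` vanishes. -/
theorem eq_zero_of_kernel_eq_at_pi {n n' k k' G G' ρ : ℝ → ℝ → ℂ} {p : ℝ → ℂ}
    (hn : Continuous n.uncurry) (hn' : Continuous n'.uncurry)
    (hk : IsTransformationKernel n k G) (hk' : IsTransformationKernel n' k' G')
    (hρ : Continuous ρ.uncurry) (hp : Continuous p)
    (hdiff : ∀ x s, 0 ≤ s → s ≤ x → x ≤ π → n x s - n' x s = ρ x s * p s)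
    (hρ_ne : ∀ s, 0 ≤ s → s < π → (∫ z in s..π, ρ z s) ≠ 0)
    (hkk : ∀ s ∈ Icc 0 π, k π s = k' π s) {b : ℝ} (hb0 : 0 ≤ b) (hb : b < π) : p b = 0 := by
  have hbound : ∀ u : ℝ → ℝ → ℂ, Continuous u.uncurry →
      ∃ C, 0 ≤ C ∧ ∀ x s, 0 ≤ s → s ≤ x → x ≤ π → ‖u x s‖ ≤ C := fun u hu => by
    obtain ⟨C, hC⟩ := ((isCompact_Icc (a := 0) (b := π)).prod
      (isCompact_Icc (a := 0) (b := π))).exists_bound_of_continuousOn hu.continuousOn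
    exact ⟨C, (norm_nonneg _).trans (hC (0, 0) ⟨⟨le_rfl, pi_pos.le⟩, ⟨le_rfl, pi_pos.le⟩⟩),
      fun x s h0 h1 h2 => hC (x, s) ⟨⟨h0.trans h1, h2⟩, ⟨h0, h1.trans h2⟩⟩⟩
  obtain ⟨Cρ, hCρ0, hCρ⟩ := hbound ρ hρ
  obtain ⟨Ck, hCk0, hCk⟩ := hbound k hk.continuous_kernel
  obtain ⟨Cn, hCn0, hCn⟩ := hbound n' hn'
  have hAc : Continuous fun s => ∫ z in s..π, ρ z s :=
    continuous_integral_param (f := fun s z => ρ z s) (hρ.comp continuous_swap) continuous_id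
      continuous_const
  -- The integral of `ρ` vanishes at `s = π`, so a positive lower bound `α` is available only on
  -- `[0, b]` with `b < π`.
  obtain ⟨s₁, hs₁, hmin⟩ := (isCompact_Icc (a := 0) (b := b)).exists_isMinOn
    (nonempty_Icc.2 hb0) hAc.norm.continuousOn
  set α := ‖∫ z in s₁..π, ρ z s₁‖ with hα
  have hα0 : 0 < α := norm_pos_iff.2 (hρ_ne s₁ hs₁.1 (hs₁.2.trans_lt hb))
  set K := Cρ * Ck + Cn with hK
  -- `W` is chosen so that `ε W ≤ 1` yields both smallness conditions `hε1` and `hε2`, used to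
  -- absorb the remainder in `h3` and `h4`.
  set W := 2 + 2 * (2 * π * Cρ + 2) / α with hW
  have hW0 : 0 < W := by positivity
  set β := π * K * W + 1 with hβ
  have hβ0 : 0 < β := by positivity
  set ε := π * K / β with hε
  have hε0 : 0 ≤ ε := by positivity
  have hεW : ε * W ≤ 1 := by
    rw [hε, div_mul_eq_mul_div, div_le_one hβ0]; linarith
  have hε1 : 2 * ε ≤ 1 := by
    have : 0 ≤ ε * (2 * (2 * π * Cρ + 2) / α) := by positivity
    rw [hW] at hεW
    linarith
  have hε2 : ε * (2 * (2 * π * Cρ + 2)) ≤ α := by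
    have h1 : ε * (2 * (2 * π * Cρ + 2) / α) ≤ 1 := by
      rw [hW] at hεW
      linarith
    rwa [← mul_div_assoc, div_le_one hα0] at h1
  obtain ⟨s₀, hs₀, hqmax⟩ := (isCompact_Icc (a := 0) (b := b)).exists_isMaxOn
    (nonempty_Icc.2 hb0) (f := fun s => ‖p s‖ * rexp (-(β * s))) (by fun_prop)
  have hΩ : IsCompact {q : ℝ × ℝ | 0 ≤ q.2 ∧ q.2 ≤ b ∧ q.2 ≤ q.1 ∧ q.1 ≤ π} := by
    refine ((isCompact_Icc (a := 0) (b := π)).prod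
      (isCompact_Icc (a := 0) (b := b))).of_isClosed_subset ?_ fun q hq =>
        ⟨⟨hq.1.trans hq.2.2.1, hq.2.2.2⟩, hq.1, hq.2.1⟩
    exact (isClosed_le continuous_const continuous_snd).inter
      ((isClosed_le continuous_snd continuous_const).inter
        ((isClosed_le continuous_snd continuous_fst).inter
          (isClosed_le continuous_fst continuous_const)))
  have hkd : Continuous fun q : ℝ × ℝ => k q.1 q.2 - k' q.1 q.2 :=
    hk.continuous_kernel.sub hk'.continuous_kernel
  obtain ⟨⟨x₂, s₂⟩, hs₂, hmmax⟩ := hΩ.exists_isMaxOn ⟨(π, 0), le_rfl, hb0, pi_pos.le, le_rfl⟩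
    (f := fun q => ‖k q.1 q.2 - k' q.1 q.2‖ * rexp (-(β * q.2)))
    (hkd.norm.mul (by fun_prop)).continuousOn
  set q := ‖p s₀‖ * rexp (-(β * s₀)) with hq
  set m := ‖k x₂ s₂ - k' x₂ s₂‖ * rexp (-(β * s₂)) with hm
  have hq0 : 0 ≤ q := by positivity
  have hm0 : 0 ≤ m := by positivity
  have hle : ∀ {u v s : ℝ}, u * rexp (-(β * s)) ≤ v ↔ u ≤ v * rexp (β * s) := fun {u v s} => by
    rw [Real.exp_neg, ← div_eq_mul_inv, div_le_iff₀ (Real.exp_pos _)]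
  have hqb : ∀ s, 0 ≤ s → s ≤ b → ‖p s‖ ≤ q * rexp (β * s) := fun s h0 h1 =>
    hle.1 (hqmax ⟨h0, h1⟩)
  have hmb : ∀ x s, 0 ≤ s → s ≤ b → s ≤ x → x ≤ π → ‖k x s - k' x s‖ ≤ m * rexp (β * s) :=
    fun x s h0 h1 h2 h3 => hle.1 (hmmax (a := (x, s)) ⟨h0, h1, h2, h3⟩)
  have hrem : ∀ x s, 0 ≤ s → s ≤ b → s ≤ x → x ≤ π →
      ‖k x s - k' x s - (∫ z in s..x, ρ z s) * p s‖ ≤ ε * (q + m) * rexp (β * s) := by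
    intro x s h0 h1 h2 h3
    have hi : ∀ u : ℝ → ℝ → ℂ, Continuous u.uncurry →
        IntervalIntegrable (fun z => u z s) MeasureTheory.volume s x := fun u hu =>
      (continuous_uncurry_comp₂ hu continuous_id continuous_const).intervalIntegrable _ _
    rw [hk.kernel_eq, hk'.kernel_eq, ← intervalIntegral.integral_mul_const,
      ← intervalIntegral.integral_sub (hi G hk.continuous_source) (hi G' hk'.continuous_source),
      ← intervalIntegral.integral_sub ((hi G hk.continuous_source).sub
        (hi G' hk'.continuous_source)) ((hi ρ hρ).mul_const _)]
    refine (intervalIntegral.norm_integral_le_of_norm_le_const fun z hz => ?_).trans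
      (?_ : (Cρ * q * Ck + Cn * m) * rexp (β * s) / β * |x - s| ≤ _)
    · rw [uIoc_of_le h2] at hz
      exact norm_source_sub_le hn hn' hk hk' hdiff hβ0 hCρ0 hCk0 hCn0 hq0 hm0 hCρ hCk hCn hqb hmb
        h0 h1 hz.1.le (hz.2.trans h3)
    · rw [abs_of_nonneg (sub_nonneg.2 h2)]
      have hD : Cρ * q * Ck + Cn * m ≤ K * (q + m) := by
        have e1 : 0 ≤ Cρ * Ck * m := by positivity
        have e2 : 0 ≤ Cn * q := by positivity
        rw [hK]; linarith
      calc _ ≤ K * (q + m) * rexp (β * s) / β * π := by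
            gcongr
            linarith
        _ = _ := by rw [hε]; ring
  have hρint : ∀ x s, 0 ≤ s → s ≤ x → x ≤ π → ‖∫ z in s..x, ρ z s‖ ≤ π * Cρ := by
    intro x s h0 h1 h2
    refine (intervalIntegral.norm_integral_le_of_norm_le_const fun z hz => ?_).trans
      (?_ : Cρ * |x - s| ≤ _)
    · rw [uIoc_of_le h1] at hz
      exact hCρ z s h0 hz.1.le (hz.2.trans h2)
    · rw [abs_of_nonneg (sub_nonneg.2 h1), mul_comm]
      gcongr
      linarith
  have h1 : m ≤ π * Cρ * q + ε * (q + m) := by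
    rw [hm, hle, ← hm]
    have e1 := hrem x₂ s₂ hs₂.1 hs₂.2.1 hs₂.2.2.1 hs₂.2.2.2
    have e2 : ‖(∫ z in s₂..x₂, ρ z s₂) * p s₂‖ ≤ π * Cρ * (q * rexp (β * s₂)) := by
      rw [norm_mul]
      exact mul_le_mul (hρint _ _ hs₂.1 hs₂.2.2.1 hs₂.2.2.2) (hqb _ hs₂.1 hs₂.2.1)
        (norm_nonneg _) (by positivity)
    have e3 := norm_le_norm_sub_add (k x₂ s₂ - k' x₂ s₂) ((∫ z in s₂..x₂, ρ z s₂) * p s₂)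
    linarith
  -- At `x = π` the kernels agree, so the leading term is no larger than the remainder.
  have h2 : α * q ≤ ε * (q + m) := by
    rw [hq, ← mul_assoc, hle, ← hq]
    have e1 := hrem π s₀ hs₀.1 hs₀.2 (hs₀.2.trans hb.le) le_rfl
    rw [hkk s₀ ⟨hs₀.1, hs₀.2.trans hb.le⟩, sub_self, zero_sub, norm_neg, norm_mul] at e1
    refine le_trans ?_ e1
    gcongr
    exact hmin hs₀
  have h3 : m ≤ (2 * π * Cρ + 1) * q := by
    have e1 : 2 * ε * m ≤ 1 * m := by gcongr
    have e2 : 2 * ε * q ≤ 1 * q := by gcongr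
    nlinarith
  have h4 : α * q ≤ α * q / 2 := by
    have e1 : ε * (q + m) ≤ ε * ((2 * π * Cρ + 2) * q) := by
      gcongr
      linarith
    have e2 : ε * (2 * (2 * π * Cρ + 2)) * q ≤ α * q := by gcongr
    linarith
  have h5 : q ≤ 0 := by
    by_contra hcon
    have := mul_pos hα0 (not_le.1 hcon)
    linarith
  have h6 := hqb b hb0 le_rfl
  rw [le_antisymm h5 hq0, zero_mul] at h6
  exact norm_le_zero_iff.1 h6

/-- Uniqueness for a single unknown convolution factor. -/
theorem eqOn_of_sameSpectrum {M N R : ℝ → ℝ → ℂ} {P P' : ℝ → ℂ}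
    (hM : ContinuousOn (fun q : ℝ × ℝ => M q.1 q.2) triangle)
    (hN : ContinuousOn (fun q : ℝ × ℝ => N q.1 q.2) triangle)
    (hR : ContinuousOn (fun q : ℝ × ℝ => R q.1 q.2) triangle)
    (hP : ContinuousOn P (Icc 0 π)) (hP' : ContinuousOn P' (Icc 0 π))
    (hdiff : ∀ x t, (x, t) ∈ triangle → M x t - N x t = R x t * (P (x - t) - P' (x - t)))
    (hR_ne : ∀ x : ℝ, 0 < x → x ≤ π → (∫ t in (0 : ℝ)..x, R (π - t) (x - t)) ≠ 0)
    (h : SameSpectrum M N) : EqOn P P' (Icc 0 π) := by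
  obtain ⟨k, G, hk⟩ := exists_isTransformationKernel_lagKernel hM
  obtain ⟨k', G', hk'⟩ := exists_isTransformationKernel_lagKernel hN
  have hkk := kernel_eq_of_charFun_eq hk.continuous_kernel hk'.continuous_kernel
    (charFun_eq_of_sameSpectrum hM hN hk hk' h)
  set p : ℝ → ℂ := fun s => P (clampPi s) - P' (clampPi s) with hp
  have hpc : Continuous p :=
    (hP.comp_continuous continuous_clampPi clampPi_mem).sub
      (hP'.comp_continuous continuous_clampPi clampPi_mem)
  have hp0 : EqOn p 0 (Ico 0 π) := fun b hb => by
    refine eq_zero_of_kernel_eq_at_pi (continuous_lagKernel hM) (continuous_lagKernel hN) hk hk'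
      (continuous_lagKernel hR) hpc ?_ ?_ hkk hb.1 hb.2
    · intro x s h0 h1 h2
      have := hdiff x (x - s) ⟨by simpa using h1, by simpa using h0, h2⟩
      rw [sub_sub_cancel] at this
      rw [lagKernel_eq M h0 h1 h2, lagKernel_eq N h0 h1 h2, lagKernel_eq R h0 h1 h2, hp]
      simp only [clampPi_of_mem h0 (h1.trans h2)]
      rw [← mul_sub, this, mul_assoc]
    · intro s h0 h1
      have e1 : ∫ z in s..π, lagKernel R z s = ∫ z in s..π, Complex.I * R z (z - s) := by
        refine intervalIntegral.integral_congr fun z hz => ?_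
        rw [uIcc_of_le h1.le] at hz
        exact lagKernel_eq R h0 hz.1 hz.2
      -- The substitution `z = π - t` identifies the integral with the hypothesis on `R` at `x = π -
      -- s`.
      have e2 := intervalIntegral.integral_comp_sub_left (a := 0) (b := π - s)
        (fun z => R z (z - s)) π
      rw [sub_sub_cancel, sub_zero] at e2
      rw [e1, intervalIntegral.integral_const_mul, ← e2]
      refine mul_ne_zero Complex.I_ne_zero ?_
      have e3 := hR_ne (π - s) (by linarith) (by linarith)
      simpa only [sub_right_comm π s] using e3
  -- The endpoint `s = π`, where the integral degenerates, is reached by continuity.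
  have hp1 : EqOn p 0 (Icc 0 π) := by
    rw [← closure_Ico pi_ne_zero.symm]
    exact hp0.closure hpc continuous_const
  intro s hs
  have := hp1 hs
  simp only [hp, clampPi_of_mem hs.1 hs.2, Pi.zero_apply] at this
  exact sub_eq_zero.1 this

/-! ### Truncated kernels and induction over the factors. -/

theorem continuousOn_truncKernel {M₀ : ℝ → ℝ → ℂ} {R : ℕ → ℝ → ℝ → ℂ} {P : ℕ → ℝ → ℂ} {k : ℕ}
    (hM₀ : ContinuousOn (fun q : ℝ × ℝ => M₀ q.1 q.2) triangle)
    (hR : ∀ j ∈ Finset.Icc 1 k, ContinuousOn (fun q : ℝ × ℝ => R j q.1 q.2) triangle)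
    (hP : ∀ j ∈ Finset.Icc 1 k, ContinuousOn (P j) (Icc 0 π)) :
    ContinuousOn (fun q : ℝ × ℝ => truncKernel M₀ R P k q.1 q.2) triangle := by
  refine hM₀.add (continuousOn_finsetSum _ fun j hj => (hR j hj).mul
    ((hP j hj).comp (f := fun q : ℝ × ℝ => q.1 - q.2) (by fun_prop) fun q hq => ?_))
  exact ⟨sub_nonneg.2 hq.2.1, by linarith [hq.1, hq.2.2]⟩

theorem truncKernel_congr {M₀ : ℝ → ℝ → ℂ} {R : ℕ → ℝ → ℝ → ℂ} {P P' : ℕ → ℝ → ℂ} {k : ℕ}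
    (h : ∀ j ∈ Finset.Icc 1 k, EqOn (P j) (P' j) (Icc 0 π)) {x t : ℝ} (hxt : (x, t) ∈ triangle) :
    truncKernel M₀ R P k x t = truncKernel M₀ R P' k x t := by
  unfold truncKernel
  congr 1
  refine Finset.sum_congr rfl fun j hj => ?_
  rw [h j hj ⟨sub_nonneg.2 hxt.2.1, by linarith [hxt.1, hxt.2.2]⟩]

theorem theorem1 (p : ℕ∞) (hp : 1 ≤ p)
    (M₀ : ℝ → ℝ → ℂ) (R : ℕ → ℝ → ℝ → ℂ) (P P' : ℕ → ℝ → ℂ) (M M' : ℝ → ℝ → ℂ)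
    (hM₀ : ContinuousOn (fun q : ℝ × ℝ => M₀ q.1 q.2) triangle)
    (hR : ∀ j ∈ indexSet p, ContinuousOn (fun q : ℝ × ℝ => R j q.1 q.2) triangle)
    (hP : ∀ j ∈ indexSet p, ContinuousOn (P j) (Icc 0 π))
    (hP' : ∀ j ∈ indexSet p, ContinuousOn (P' j) (Icc 0 π))
    (hR_ne : ∀ j ∈ indexSet p, ∀ x : ℝ, 0 < x → x ≤ π →
      (∫ t in (0 : ℝ)..x, R j (π - t) (x - t)) ≠ 0)
    (hM : IsFullKernel p M₀ R P M)
    (hM' : IsFullKernel p M₀ R P' M')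
    (hspec : ∀ k ∈ indexSet p, SameSpectrum (truncKernel M₀ R P k) (truncKernel M₀ R P' k)) :
    ∀ x t : ℝ, (x, t) ∈ triangle → M x t = M' x t := by
  have hmono : ∀ k ∈ indexSet p, ∀ j ∈ Finset.Icc 1 k, j ∈ indexSet p := fun k hk j hj =>
    ⟨(Finset.mem_Icc.1 hj).1, (Nat.cast_le.2 (Finset.mem_Icc.1 hj).2).trans hk.2⟩
  have hPP : ∀ j ∈ indexSet p, EqOn (P j) (P' j) (Icc 0 π) := by
    intro j
    induction j using Nat.strong_induction_on with
    | _ j ih =>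
      intro hj
      obtain ⟨i, rfl⟩ := Nat.exists_eq_add_of_le' hj.1
      refine eqOn_of_sameSpectrum
        (continuousOn_truncKernel hM₀ (fun l hl => hR l (hmono _ hj l hl))
          fun l hl => hP l (hmono _ hj l hl))
        (continuousOn_truncKernel hM₀ (fun l hl => hR l (hmono _ hj l hl))
          fun l hl => hP' l (hmono _ hj l hl))
        (hR _ hj) (hP _ hj) (hP' _ hj) (fun x t hxt => ?_) (hR_ne _ hj) (hspec _ hj)
      -- By the induction hypothesis the first `i` terms coincide, so only the term of index `i + 1`
      -- remains in the difference.
      have h1 := truncKernel_congr (M₀ := M₀) (R := R) (P := P) (P' := P') (k := i)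
        (fun l hl => ih l (by have := (Finset.mem_Icc.1 hl).2; omega)
          (hmono _ hj l (Finset.Icc_subset_Icc_right (Nat.le_succ i) hl))) hxt
      unfold truncKernel at h1 ⊢
      rw [Finset.sum_Icc_succ_top (Nat.le_add_left 1 i),
        Finset.sum_Icc_succ_top (Nat.le_add_left 1 i)]
      linear_combination h1
  have htrunc : ∀ (k : ℕ), (k : ℕ∞) ≤ p → ∀ x t, (x, t) ∈ triangle →
      truncKernel M₀ R P k x t = truncKernel M₀ R P' k x t := fun k hk x t hxt =>
    truncKernel_congr (fun j hj => hPP j ⟨(Finset.mem_Icc.1 hj).1,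
      (Nat.cast_le.2 (Finset.mem_Icc.1 hj).2).trans hk⟩) hxt
  intro x t hxt
  induction p with
  | top =>
    have h1 := (hM.2 rfl).tendsto_at hxt
    have h2 := (hM'.2 rfl).tendsto_at hxt
    exact tendsto_nhds_unique (h1.congr fun k => htrunc k le_top x t hxt) h2
  | coe n => rw [hM.1 n rfl x t hxt, hM'.1 n rfl x t hxt, htrunc n le_rfl x t hxt]
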